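/- **Definitions.** For a Boolean matrix $A$, $\bar A$ is its entrywise complement and $|A|$ (the weight) its number of ones; $A$ is $k$-free if it has no all-ones $k\times k$ submatrix. A rectifier circuit (OR-circuit) for $m\times n$ matrices is a finite directed acyclic graph in which $n$ vertices are labelled as inputs and $m$ other vertices as outputs; it implements $A$ if for all $i,j$ one has $A[i,j]=1$ exactly when there is a directed path from the $j$-th input to the $i$-th output. $\mathsf{OR}(A)$ is the least number of edges of a rectifier circuit that implements $A$. For an $m\times m$ Boolean matrix $A$, its *2-rectangle matrix* $B$ is the $\binom m2\times\binom m2$ matrix whose rows and columns are labelled by the 2-element subsets of the index set of $A$, with $B[a,b]=1$ iff $A[i,j]=1$ for all $i\in a$, $j\in b$. If $\binom m2\le n$, let $B^{(n)}$ be the $n\times n$ matrix obtained from $B$ by adding $n-\binom m2$ zero rows and zero columns. *Norm-graph matrix.* For a prime power $q$ and $t\ge 1$, rows and columns are labelled by the elements of $\mathbb F_{q^t}$, and the entry at $(x,y)$ is $1$ iff $N(x+y)=1$, where $N(z)=z\cdot z^q\cdots z^{q^{t-1}}$. For given $n$ put $\ell=\lfloor\log_2 n\rfloor$ and $t=\Big\lfloor\sqrt{\lfloor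 \ell/\lfloor\log_2 \ell\rfloor\rfloor}\Big\rfloor$, and let $q=2^s$ with $s$ the greatest integer such that $\binom{q^t}{2}\le n$. *Brown's matrix.* For an odd prime $p$, rows and columns are labelled by the points of $\mathbb F_p^3$, and the entry at $(x,y)$ is $1$ iff $\sum_{i=1}^3(x_i-y_i)^2=\alpha$, where $\alpha$ is the least natural number such that $-\alpha$ is not a square modulo $p$. For given $n$ let $p$ be the greatest prime such that $\binom{p^3}{2}\le n$. **Theorem.** (i) For all sufficiently large $n$, let $C$ be the complement of the $n\times n$ matrix $B^{(n)}$ built from the norm-graph matrix $A$ with the parameters $q,t$ above. Then $\mathsf{OR}(C)>0$ and $$\frac{\mathsf{OR}(\bar C)}{\mathsf{OR}(C)} = n\cdot 2^{-f(n)},\qquad f(n)\ge 0,\quad f(n)=O\big(\sqrt{\ln n\,\ln\ln n}\big)\quad(n\to\infty).$$ (ii) For all sufficiently large $n$, let $C$ be the complement of the $n\times n$ matrix $B^{(n)}$ built from Brown's matrix $A$ with the prime $p$ above. Then $\mathsf{OR}(C)=O(n)$ as $n\to\infty$, the matrix $\bar C$ is $2$-free for all sufficiently large $n$, and $|\bar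 C|=\Omega(n^{4/3})$. -/

import Mathlib

open Filter Asymptotics

noncomputable section

namespace RelOR

/-! ### Boolean matrices -/

/-- The complement of a Boolean matrix. -/
def compl {I J : Type*} (A : Matrix I J Bool) : Matrix I J Bool :=
  Matrix.of fun i j => !(A i j)

/-- The weight of a Boolean matrix: its number of ones. -/
def weight {I J : Type*} (A : Matrix I J Bool) : ℕ :=
  Set.ncard {e : I × J | A e.1 e.2 = true}

/-- `A` is `k`-free: it has no all-ones `k × k` submatrix. -/
def IsFree {I J : Type*} (k : ℕ) (A : Matrix I J Bool) : Prop :=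
  ¬ ∃ (R : Finset I) (S : Finset J), R.card = k ∧ S.card = k ∧
    ∀ i ∈ R, ∀ j ∈ S, A i j = true

/-! ### Rectifier circuits -/

/-- Vertices of a rectifier circuit: one input per column `j : J`, one output per row `i : I`,
and `h` further vertices. -/
abbrev Vertex (I J : Type*) (h : ℕ) : Type _ := J ⊕ (I ⊕ Fin h)

/-- A rectifier circuit (OR-circuit): a directed acyclic graph with vertices labelled as inputs
and vertices labelled as outputs. -/
structure Circuit (I J : Type*) where
  /-- the number of vertices that are neither inputs nor outputs -/
  inner : ℕ
  /-- the set of directed edges -/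
  edges : Finset (Vertex I J inner × Vertex I J inner)
  acyclic : ∀ v, ¬ Relation.TransGen (fun u w => (u, w) ∈ edges) v v

/-- The complexity of a circuit: its number of edges. -/
def Circuit.size {I J : Type*} (S : Circuit I J) : ℕ := S.edges.card

/-- There is a directed path from the `j`-th input to the `i`-th output. -/
def Circuit.Connects {I J : Type*} (S : Circuit I J) (j : J) (i : I) : Prop :=
  Relation.ReflTransGen (fun u w => (u, w) ∈ S.edges) (Sum.inl j) (Sum.inr (Sum.inl i))

def Circuit.Implements {I J : Type*} (S : Circuit I J) (A : Matrix I J Bool) : Prop :=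
  ∀ i j, A i j = true ↔ S.Connects j i

/-- The OR-complexity of a Boolean matrix: the least number of edges of a rectifier circuit
that implements it. (For finite `I`, `J` such a circuit exists: join the `j`-th input to the
`i`-th output by an edge whenever `A i j = true`.) -/
def OR {I J : Type*} (A : Matrix I J Bool) : ℕ :=
  sInf {s : ℕ | ∃ S : Circuit I J, S.Implements A ∧ S.size = s}

/-! ### The 2-rectangle matrix -/

/-- The 2-element subsets of `V`. -/
abbrev Pairs (V : Type*) : Type _ := {s : Finset V // s.card = 2}

open scoped Classical in
/-- The 2-rectangle matrix of `A`: rows and columns are labelled by 2-element subsets of `V`,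
with a one at `(a, b)` iff the submatrix of `A` with rows `a` and columns `b` is all-ones. -/
def rectMatrix {V : Type*} (A : Matrix V V Bool) : Matrix (Pairs V) (Pairs V) Bool :=
  Matrix.of fun a b => decide (∀ i ∈ a.1, ∀ j ∈ b.1, A i j = true)

/-- Labels of the rows and columns of the 2-rectangle matrix of a `V × V` matrix, filled up to
`n` labels in all (if there are at most `n` of them). -/
abbrev PadIndex (V : Type*) (n : ℕ) : Type _ := Pairs V ⊕ Fin (n - (Nat.card V).choose 2)

/-- The 2-rectangle matrix of `A`, filled up by zero rows and zero columns. -/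
def padRect {V : Type*} (A : Matrix V V Bool) (n : ℕ) :
    Matrix (PadIndex V n) (PadIndex V n) Bool :=
  Matrix.of fun a b =>
    match a, b with
    | Sum.inl a, Sum.inl b => rectMatrix A a b
    | _, _ => false

/-! ### The norm-graph matrices -/

open scoped Classical in
/-- The norm-graph matrix over a field `F` (meant to have `q ^ t` elements): a one at `(x, y)`
iff `x + y` has norm `1`, where `N(z) = z * z ^ q * ⋯ * z ^ (q ^ (t - 1))` is the norm from
`F` to its subfield with `q` elements. -/
def normMatrix (F : Type*) [Field F] (q t : ℕ) : Matrix F F Bool :=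
  Matrix.of fun x y => decide (∏ i ∈ Finset.range t, (x + y) ^ (q ^ i) = 1)

/-- The degree of the field extension that is used for size `n`: about
`√(log n / log log n)`, with binary logarithms. -/
def normDeg (n : ℕ) : ℕ := Nat.sqrt (Nat.log 2 n / Nat.log 2 (Nat.log 2 n))

/-- The base field that is used for size `n` has `q = 2 ^ normExp n` elements, where the exponent
is the greatest one for which the 2-rectangle matrix, of size `(q ^ t).choose 2`, fits. -/
def normExp (n : ℕ) : ℕ :=
  Nat.findGreatest (fun s => (2 ^ (s * normDeg n)).choose 2 ≤ n) n

abbrev NormField (n : ℕ) : Type := GaloisField 2 (normExp n * normDeg n)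

abbrev NormIndex (n : ℕ) : Type := PadIndex (NormField n) n

/-- The complement of the (padded) 2-rectangle matrix of the norm-graph matrix. -/
def normC (n : ℕ) : Matrix (NormIndex n) (NormIndex n) Bool :=
  compl (padRect (normMatrix (NormField n) (2 ^ normExp n) (normDeg n)) n)

/-! ### Brown's matrices -/

/-- The least natural number `α` such that `-α` is not a square modulo `p`; so `α = 1` if
`p ≡ 3` modulo `4`, and `α` is the least quadratic non-residue if `p ≡ 1` modulo `4`. -/
def brownAlpha (p : ℕ) : ℕ := sInf {a : ℕ | ¬ IsSquare (-(a : ZMod p))}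

/-- Brown's matrix: rows and columns are labelled by the points of the affine 3-space over the
integers modulo `p`, with a one at `(x, y)` iff `y` lies on the sphere
`∑ (x i - y i) ^ 2 = α` about `x`. -/
def brownMatrix (p : ℕ) : Matrix (Fin 3 → ZMod p) (Fin 3 → ZMod p) Bool :=
  Matrix.of fun x y => decide (∑ i, (x i - y i) ^ 2 = (brownAlpha p : ZMod p))

/-- The greatest prime `p` for which the 2-rectangle matrix of Brown's `p ^ 3 × p ^ 3` matrix
fits into an `n × n` matrix. -/
def brownPrime (n : ℕ) : ℕ :=
  Nat.findGreatest (fun p => p.Prime ∧ (p ^ 3).choose 2 ≤ n) n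

abbrev BrownIndex (n : ℕ) : Type := PadIndex (Fin 3 → ZMod (brownPrime n)) n

/-- The complement of the (padded) 2-rectangle matrix of Brown's matrix. -/
def brownC (n : ℕ) : Matrix (BrownIndex n) (BrownIndex n) Bool :=
  compl (padRect (brownMatrix (brownPrime n)) n)

end RelOR

end

/-! A complemented 2-rectangle matrix is cheap: C has a one at (a,b) iff some i ∈ a, j ∈ b have
A[i,j] = 0. So C is a Boolean product of an incidence matrix with two ones per row, the complement
of A, and a transposed incidence matrix. The outer factors have O(n) ones, and the middle one has
about |V|² = O(n) entries, hence OR(C) = O(n) (`OR_compl_padRect_le`).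

The complement of C is B itself, which is expensive if A is dense but has no large all-ones
submatrix. Freeness passes from A to B (`isFree_padRect`); density passes by Cauchy–Schwarz, since a
d-regular A with d² ≥ 4|V| contains on the order of d⁴ all-ones 2×2 submatrices
(`pow_four_le_weight_padRect`). Finally, a (k+1)-free matrix has OR-complexity at least its weight
divided by k² + 2k (`weight_le_mul_OR`).

Brown's matrix is 3-free, because three spheres with distinct centres have at most two common
points, and has degree about p²; this gives (ii). For (i), the norm-graph matrix has degree at least
q^(t-1), and its freeness is a bound on the solutions of a system ∏ⱼ (xⱼ - aᵢⱼ) = bᵢ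
(`card_image_solutions_le`). With l = log n and L = log log n, the density loss is of exponent O(s +
t) and the freeness loss of exponent O(Lt). As st = O(l), the choice t ≈ √(l/L) balances the two at
O(√(lL)). -/

namespace RelOR

open MvPolynomial

/-! ### Systems of shifted products, and freeness of norm-graph matrices -/

section ShiftedProducts

variable {σ K : Type} [Fintype σ] [Field K]

/-- The product of the shifted variables `X j - a i j` over all `j`. -/
noncomputable def shiftProd (a : σ → σ → K) (i : σ) : MvPolynomial σ K :=
  ∏ j, (X j - C (a i j))

/-- If the shifts of each variable are pairwise distinct, the polynomial ring is integral over the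
subalgebra generated by the products of shifted variables. -/
theorem isIntegral_adjoin_shiftProd {a : σ → σ → K}
    (ha : ∀ j, Function.Injective fun i => a i j) (j₀ : σ) :
    IsIntegral (Algebra.adjoin K (Set.range (shiftProd a))) (X j₀ : MvPolynomial σ K) := by
  classical
  set S := Algebra.adjoin K (Set.range (shiftProd a)) with hS
  let L := FractionRing (MvPolynomial σ K)
  let φ : MvPolynomial σ K →+* L := algebraMap _ _
  have hφ : Function.Injective φ := IsFractionRing.injective _ _
  rw [← isIntegral_algebraMap_iff (B := L) hφ]
  by_contra hx
  -- An element outside the integrally closed ring is missed by some valuation ring containing that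
  -- ring.
  obtain ⟨V, hV, hXV⟩ := Subring.exists_le_valuationSubring_of_isIntegrallyClosedIn
    (R := (integralClosure S L).toSubring) (x := φ (X j₀)) hx
  have hmem : ∀ p ∈ S, φ p ∈ V := fun p hp =>
    hV (show IsIntegral S (algebraMap S L ⟨p, hp⟩) from isIntegral_algebraMap)
  have hC : ∀ c : K, φ (C c) ∈ V := fun c => hmem _ (S.algebraMap_mem c)
  have hg : ∀ i, φ (shiftProd a i) ∈ V := fun i =>
    hmem _ (Algebra.subset_adjoin ⟨i, rfl⟩)
  have hgt : ∀ j, φ (X j) ∉ V → ∀ c, 1 < V.valuation (φ (X j - C c)) := by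
    intro j hj c
    rw [← not_le, ValuationSubring.valuation_le_one_iff]
    intro h
    apply hj
    have := V.add_mem _ _ h (hC c)
    simpa using this
  -- The i-th product lies in `V` although its factor at `j₀` has valuation above 1, so another
  -- factor must have valuation below 1.
  have key : ∀ i, ∃ j, j ≠ j₀ ∧ V.valuation (φ (X j - C (a i j))) < 1 := by
    intro i
    by_contra! h
    have h1 : ∀ j, 1 ≤ V.valuation (φ (X j - C (a i j))) := by
      intro j
      by_cases hj : j = j₀
      · subst hj; exact (hgt _ hXV _).le
      · exact h j hj
    have h2 := (V.valuation_le_one_iff _).2 (hg i)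
    rw [shiftProd, map_prod, map_prod, ← Finset.mul_prod_erase _ _ (Finset.mem_univ j₀)] at h2
    have h3 : 1 ≤ ∏ j ∈ Finset.univ.erase j₀, V.valuation (φ (X j - C (a i j))) :=
      Finset.one_le_prod' fun j _ => h1 j
    exact absurd ((hgt j₀ hXV (a i j₀)).trans_le (le_mul_of_one_le_right' h3)) (not_lt.2 h2)
  choose f hf hlt using key
  -- Since `f` misses `j₀`, two indices share a variable. Subtracting the two small factors leaves a
  -- nonzero constant of valuation below 1, which is impossible for a unit of `K`.
  have hninj : ¬ Function.Injective f := fun h => by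
    obtain ⟨i, hi⟩ := (Finite.injective_iff_surjective.1 h) j₀
    exact hf i hi
  simp only [Function.Injective, not_forall] at hninj
  obtain ⟨i, i', hii, hne⟩ := hninj
  have hd : a i' (f i) - a i (f i) ≠ 0 := fun h => hne (ha (f i) (sub_eq_zero.1 h).symm)
  have hlt1 : V.valuation (φ (C (a i' (f i) - a i (f i)))) < 1 := by
    have h2 := hlt i'
    rw [← hii] at h2
    have := V.valuation.map_sub_lt (hlt i) h2
    rwa [← map_sub, show (X (f i) - C (a i (f i)) - (X (f i) - C (a i' (f i))) :
      MvPolynomial σ K) = C (a i' (f i) - a i (f i)) by rw [C_sub]; ring] at this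
  have hle := (V.valuation_le_one_iff _).2 (hC (a i' (f i) - a i (f i))⁻¹)
  have := mul_lt_one_of_lt_of_le hlt1 hle
  rw [← map_mul, ← map_mul, ← C_mul, mul_inv_cancel₀ hd] at this
  simp at this

/-- By integrality the |σ| products generate a subalgebra over which the whole polynomial ring is
algebraic. As the transcendence degree is |σ|, they form a transcendence basis. -/
theorem algebraicIndependent_shiftProd {a : σ → σ → K}
    (ha : ∀ j, Function.Injective fun i => a i j) :
    AlgebraicIndependent K (shiftProd a) := by
  set S := Algebra.adjoin K (Set.range (shiftProd a)) with hS
  have htop : ∀ p : MvPolynomial σ K, IsIntegral S p := by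
    intro p
    induction p using MvPolynomial.induction_on with
    | C c => exact isIntegral_algebraMap (R := S) (x := algebraMap K S c)
    | add p q hp hq => exact hp.add hq
    | mul_X p j hp => exact hp.mul (isIntegral_adjoin_shiftProd ha j)
  have : Algebra.IsIntegral S (MvPolynomial σ K) := ⟨htop⟩
  have : Algebra.IsAlgebraic S (MvPolynomial σ K) := inferInstance
  refine (Algebra.IsAlgebraic.isTranscendenceBasis_of_le_trdeg_of_finite K (shiftProd a) ?_).1
  rw [MvPolynomial.trdeg_of_isDomain]
  simp

theorem degreeOf_shiftProd_le (a : σ → σ → K) (i j : σ) :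
    (shiftProd a i).degreeOf j ≤ 1 := by
  classical
  refine (degreeOf_prod_le _ _ _).trans ?_
  calc ∑ l, degreeOf j (X l - C (a i l)) ≤ ∑ l, if l = j then 1 else 0 := by
        refine Finset.sum_le_sum fun l _ => ?_
        refine (degreeOf_sub_le _ _ _).trans ?_
        rw [degreeOf_C, degreeOf_X]
        by_cases h : l = j <;> simp [h, eq_comm (a := j)]
    _ = 1 := by simp

theorem finrank_restrictDegree (N : ℕ) :
    Module.finrank K (restrictDegree σ K N) = (N + 1) ^ Fintype.card σ := by
  classical
  let e : {n : σ →₀ ℕ | ∀ i, n i ≤ N} ≃ (σ → Fin (N + 1)) :=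
    { toFun := fun n i => ⟨n.1 i, Nat.lt_succ_of_le (n.2 i)⟩
      invFun := fun f => ⟨Finsupp.equivFunOnFinite.symm fun i => (f i : ℕ),
        fun i => Nat.le_of_lt_succ (f i).2⟩
      left_inv := fun n => Subtype.ext (Finsupp.ext fun _ => rfl)
      right_inv := fun f => rfl }
  rw [restrictDegree,
    Module.finrank_eq_nat_card_basis (basisRestrictSupport K {n : σ →₀ ℕ | ∀ i, n i ≤ N}),
    Nat.card_congr e]
  simp

/-- The degree of a variable over the subalgebra generated by the products of shifted variables. -/
theorem natDegree_minpoly_le {a : σ → σ → K}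
    (ha : ∀ j, Function.Injective fun i => a i j) (j₀ : σ) :
    (minpoly (Algebra.adjoin K (Set.range (shiftProd a))) (X j₀ : MvPolynomial σ K)).natDegree ≤
      (Fintype.card σ + 1) ^ Fintype.card σ := by
  classical
  set S := Algebra.adjoin K (Set.range (shiftProd a)) with hS
  set d := (minpoly S (X j₀ : MvPolynomial σ K)).natDegree with hd
  have hind := algebraicIndependent_shiftProd ha
  -- `S` is itself a polynomial ring. Being integrally closed, it makes `minpoly` minimal among all
  -- nonzero annihilating polynomials, not only monic ones, so the powers of `X j₀` below `d` are
  -- independent over `S`.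
  have : IsIntegrallyClosed S := IsIntegrallyClosed.of_equiv hind.aevalEquiv.toRingEquiv
  have hint := isIntegral_adjoin_shiftProd ha j₀
  let c : Fin d → MvPolynomial σ K := fun k => X j₀ ^ (k : ℕ)
  have hc : LinearIndependent S c := by
    rw [Fintype.linearIndependent_iff]
    intro g hg
    by_contra! h
    let p : Polynomial S := ∑ k : Fin d, Polynomial.monomial (k : ℕ) (g k)
    have hcoeff : ∀ k : Fin d, p.coeff k = g k := by
      intro k
      simp [p, Polynomial.coeff_monomial, Fin.val_inj]
    have hp0 : p ≠ 0 := by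
      obtain ⟨k, hk⟩ := h
      intro hp
      rw [← hcoeff, hp, Polynomial.coeff_zero] at hk
      exact hk rfl
    have hpx : Polynomial.aeval (X j₀ : MvPolynomial σ K) p = 0 := by
      rw [← hg]
      simp [p, c, Polynomial.aeval_monomial, Algebra.smul_def]
    have h1 := minpoly.IsIntegrallyClosed.degree_le_of_ne_zero hp0 hpx
    have h2 : p.degree < d := by
      refine (Polynomial.degree_sum_le _ _).trans_lt ?_
      refine (Finset.sup_lt_iff (WithBot.bot_lt_coe d)).2 fun k _ => ?_
      exact (Polynomial.degree_monomial_le _ _).trans_lt (WithBot.coe_lt_coe.2 k.2)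
    rw [Polynomial.degree_eq_natDegree (minpoly.ne_zero hint)] at h1
    exact absurd h2 (not_lt.2 h1)
  let b : (σ → Fin (d + 1)) → S := fun β =>
    hind.aevalEquiv (monomial (Finsupp.equivFunOnFinite.symm fun i => (β i : ℕ)) 1)
  have hb : LinearIndependent K b := by
    have h1 := (basisMonomials σ K).linearIndependent.comp
      (fun β : σ → Fin (d + 1) => Finsupp.equivFunOnFinite.symm fun i => (β i : ℕ)) (by
        intro β γ h
        have h := Finsupp.equivFunOnFinite.symm.injective h
        funext i
        exact Fin.ext (congrFun h i))
    exact h1.map' hind.aevalEquiv.toLinearMap (LinearMap.ker_eq_bot.2 hind.aevalEquiv.injective)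
  have hbc := linearIndependent_smul hb hc
  -- A dimension count bounds `d`. With m = |σ|, the (d+1)^m · d independent elements g^β X^k have
  -- degree at most md + d in each variable, so (d+1)^m · d ≤ (md + d + 1)^m ≤ ((m+1)(d+1))^m.
  have hN : ∀ q : (σ → Fin (d + 1)) × Fin d,
      b q.1 • c q.2 ∈ restrictDegree σ K (Fintype.card σ * d + d) := by
    rintro ⟨β, k⟩
    rw [mem_restrictDegree]
    intro s hs i
    refine (degreeOf_le_iff.1 ?_) s hs
    have hbv : ((b β : S) : MvPolynomial σ K) = ∏ l, shiftProd a l ^ (β l : ℕ) := by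
      have h := hind.algebraMap_aevalEquiv
        (monomial (Finsupp.equivFunOnFinite.symm fun i => (β i : ℕ)) 1)
      rw [aeval_monomial, Finsupp.prod_fintype _ _ (by simp),
        map_one (algebraMap K (MvPolynomial σ K)), one_mul] at h
      exact h
    rw [Subalgebra.smul_def, hbv, smul_eq_mul]
    refine (degreeOf_mul_le _ _ _).trans (Nat.add_le_add ?_ ?_)
    · refine (degreeOf_prod_le _ _ _).trans ?_
      rw [← smul_eq_mul, ← Finset.card_univ, ← Finset.sum_const]
      refine Finset.sum_le_sum fun l _ => ?_
      refine (degreeOf_pow_le _ _ _).trans ?_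
      calc (β l : ℕ) * degreeOf i (shiftProd a l) ≤ d * 1 :=
            Nat.mul_le_mul (Nat.le_of_lt_succ (β l).2) (degreeOf_shiftProd_le a l i)
        _ = d := mul_one d
    · refine (degreeOf_pow_le _ _ _).trans ?_
      rw [degreeOf_X]
      have := k.2.le
      split_ifs <;> omega
  let v : (σ → Fin (d + 1)) × Fin d → restrictDegree σ K (Fintype.card σ * d + d) :=
    fun q => ⟨_, hN q⟩
  have hv : LinearIndependent K v :=
    LinearIndependent.of_comp (restrictDegree σ K (Fintype.card σ * d + d)).subtype hbc
  have hcard := hv.fintype_card_le_finrank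
  rw [finrank_restrictDegree] at hcard
  simp only [Fintype.card_prod, Fintype.card_fun, Fintype.card_fin] at hcard
  have hle : (d + 1) ^ Fintype.card σ * d ≤
      (d + 1) ^ Fintype.card σ * (Fintype.card σ + 1) ^ Fintype.card σ := by
    refine hcard.trans ?_
    rw [← mul_pow]
    exact Nat.pow_le_pow_left (by nlinarith) _
  exact Nat.le_of_mul_le_mul_left hle (by positivity)

/-- A bound for the number of values of one coordinate on the solutions of a system of equations
`∏ j, (x j - a i j) = b i`, if the shifts of each variable are pairwise distinct. -/
theorem card_image_solutions_le {a : σ → σ → K} (ha : ∀ j, Function.Injective fun i => a i j)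
    (b : σ → K) (j₀ : σ) (T : Finset (σ → K)) (hT : ∀ x ∈ T, ∀ i, ∏ j, (x j - a i j) = b i)
    (hinj : Set.InjOn (fun x : σ → K => x j₀) T) :
    T.card ≤ (Fintype.card σ + 1) ^ Fintype.card σ := by
  classical
  rcases T.eq_empty_or_nonempty with rfl | ⟨x₀, hx₀⟩
  · simp
  set S := Algebra.adjoin K (Set.range (shiftProd a)) with hS
  have hint := isIntegral_adjoin_shiftProd ha j₀
  let ψ : (σ → K) → S →ₐ[K] K := fun x => (aeval x).comp S.val
  -- Evaluation on `S` depends only on `b`. Hence a single monic polynomial `P` over `K` has the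
  -- `j₀`-th coordinates of all solutions among its roots.
  have hψ : ∀ x ∈ T, ψ x = ψ x₀ := by
    intro x hx
    refine AlgHom.adjoin_ext ?_
    rintro _ ⟨i, rfl⟩
    simp only [ψ, AlgHom.comp_apply, Subalgebra.coe_val, shiftProd, map_prod, map_sub, aeval_X,
      aeval_C, Algebra.algebraMap_self_apply]
    rw [hT x hx i, hT x₀ hx₀ i]
  let P : Polynomial K := (minpoly S (X j₀ : MvPolynomial σ K)).map (ψ x₀ : S →+* K)
  have hP : P ≠ 0 := ((minpoly.monic hint).map _).ne_zero
  have hroot : ∀ x ∈ T, P.IsRoot (x j₀) := by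
    intro x hx
    have h := congrArg (aeval x) (minpoly.aeval S (X j₀ : MvPolynomial σ K))
    rw [Polynomial.aeval_def, ← AlgHom.coe_toRingHom, Polynomial.hom_eval₂] at h
    rw [Polynomial.IsRoot.def, Polynomial.eval_map, ← hψ x hx]
    simpa using! h
  calc T.card = (T.image fun x => x j₀).card := (Finset.card_image_of_injOn hinj).symm
    _ ≤ P.roots.toFinset.card := by
        refine Finset.card_le_card fun y hy => ?_
        obtain ⟨x, hx, rfl⟩ := Finset.mem_image.1 hy
        rw [Multiset.mem_toFinset, Polynomial.mem_roots hP]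
        exact hroot x hx
    _ ≤ P.natDegree := (Multiset.toFinset_card_le _).trans (Polynomial.card_roots' _)
    _ ≤ (minpoly S (X j₀ : MvPolynomial σ K)).natDegree := Polynomial.natDegree_map_le
    _ ≤ _ := natDegree_minpoly_le ha j₀

end ShiftedProducts

/-- The norm-graph matrices in characteristic two have no large all-ones submatrices. -/
theorem isFree_normMatrix (F : Type) [Field F] [CharP F 2] (s t : ℕ) (ht : 1 ≤ t) :
    IsFree ((t + 1) ^ t + 1) (normMatrix F (2 ^ s) t) := by
  classical
  rintro ⟨R, S, hR, hS, hRS⟩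
  have htS : t ≤ S.card := by
    rw [hS]
    have : t < (t + 1) ^ t + 1 := by
      have := Nat.lt_pow_self (n := t) (a := t + 1) (by omega)
      omega
    exact this.le
  obtain ⟨S', hS', hS'c⟩ := Finset.exists_subset_card_eq htS
  let e : Fin t ≃ S' := (S'.equivFinOfCardEq hS'c).symm
  -- Only t of the columns are used. Since Frobenius powers are additive, N(x + y) = 1 becomes ∏ⱼ
  -- (x^(q^j) + y^(q^j)) = 1, a system in the coordinates xⱼ = x^(q^j). Injectivity of Frobenius
  -- separates the shifts, and coordinate 0 recovers x.
  let a : Fin t → Fin t → F := fun i j => -((e i : F) ^ ((2 ^ s) ^ (j : ℕ)))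
  have hpow : ∀ j : ℕ, (2 ^ s) ^ j = 2 ^ (s * j) := fun j => (pow_mul 2 s j).symm
  have ha : ∀ j, Function.Injective fun i => a i j := by
    intro j i i' h
    simp only [a, hpow, neg_inj] at h
    exact e.injective (Subtype.ext (iterateFrobenius_inj F 2 _ h))
  let w : F → Fin t → F := fun x j => x ^ ((2 ^ s) ^ (j : ℕ))
  have hw0 : ∀ x, w x ⟨0, ht⟩ = x := fun x => by simp [w]
  have hwinj : Function.Injective w := fun x y h => by rw [← hw0 x, ← hw0 y, h]
  have hcard := card_image_solutions_le (a := a) ha (fun _ => 1) ⟨0, ht⟩ (R.image w) ?_ ?_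
  · rw [Finset.card_image_of_injective _ hwinj, hR, Fintype.card_fin] at hcard
    omega
  · intro _ hxw i
    obtain ⟨x, hx, rfl⟩ := Finset.mem_image.1 hxw
    have h := hRS x hx (e i) (hS' (e i).2)
    simp only [normMatrix, Matrix.of_apply, decide_eq_true_eq] at h
    rw [← h, Finset.prod_range]
    refine Finset.prod_congr rfl fun j _ => ?_
    simp only [w, a, sub_neg_eq_add, hpow]
    rw [add_pow_char_pow]
  · intro x hx y hy h
    obtain ⟨x, -, rfl⟩ := Finset.mem_image.1 (Finset.mem_coe.1 hx)
    obtain ⟨y, -, rfl⟩ := Finset.mem_image.1 (Finset.mem_coe.1 hy)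
    simp only [hw0] at h
    rw [h]

end RelOR

namespace RelOR

/-! ### Rectifier circuits: upper and lower bounds -/

section Circuits

variable {I J : Type*}

theorem Circuit.Implements.OR_le {S : Circuit I J} {A : Matrix I J Bool} (h : S.Implements A) :
    OR A ≤ S.size :=
  Nat.sInf_le ⟨S, h, rfl⟩

/-- A finite graph whose edges increase a height function gives a bound for the
OR-complexity. -/
theorem OR_le_card_of_height {W : Type*} [Finite W] {A : Matrix I J Bool}
    (E : Finset ((J ⊕ (I ⊕ W)) × (J ⊕ (I ⊕ W)))) (ht : J ⊕ (I ⊕ W) → ℕ)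
    (hht : ∀ e ∈ E, ht e.1 < ht e.2)
    (hA : ∀ i j, A i j = true ↔
      Relation.ReflTransGen (fun u w => (u, w) ∈ E) (Sum.inl j) (Sum.inr (Sum.inl i))) :
    OR A ≤ E.card := by
  classical
  let e : J ⊕ (I ⊕ W) ≃ Vertex I J (Nat.card W) :=
    Equiv.sumCongr (Equiv.refl J) (Equiv.sumCongr (Equiv.refl I) (Finite.equivFin W))
  let E' := E.map (e.prodCongr e).toEmbedding
  have hE' : ∀ u w, (u, w) ∈ E' ↔ (e.symm u, e.symm w) ∈ E := by
    intro u w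
    rw [Finset.mem_map_equiv]
    rfl
  have hlt : ∀ u w, Relation.TransGen (fun u w => (u, w) ∈ E') u w →
      ht (e.symm u) < ht (e.symm w) := by
    intro u w h
    induction h with
    | single h => exact hht _ ((hE' _ _).1 h)
    | tail _ h ih => exact ih.trans (hht _ ((hE' _ _).1 h))
  let S : Circuit I J := ⟨Nat.card W, E', fun v hv => lt_irrefl _ (hlt v v hv)⟩
  have hS : S.Implements A := by
    intro i j
    rw [hA]
    constructor
    · intro h
      exact h.lift e fun u w huw => (hE' _ _).2 (by simpa using huw)
    · intro h
      exact h.lift e.symm fun u w huw => (hE' _ _).1 huw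
  calc OR A ≤ S.size := hS.OR_le
    _ = E.card := Finset.card_map _

theorem weight_eq_card [Fintype I] [Fintype J] (A : Matrix I J Bool) :
    weight A = (Finset.univ.filter fun e : I × J => A e.1 e.2 = true).card := by
  rw [weight, ← Set.ncard_coe_finset]
  simp

variable [Finite I] [Finite J]

/-- Joining inputs directly to outputs. -/
theorem exists_circuit (A : Matrix I J Bool) :
    ∃ S : Circuit I J, S.Implements A ∧ S.size = weight A := by
  classical
  have := Fintype.ofFinite I
  have := Fintype.ofFinite J
  let g : I × J ↪ Vertex I J 0 × Vertex I J 0 :=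
    ⟨fun e => (Sum.inl e.2, Sum.inr (Sum.inl e.1)), fun e e' h => by
      simp only [Prod.mk.injEq, Sum.inl.injEq, Sum.inr.injEq] at h
      exact Prod.ext h.2 h.1⟩
  let E := (Finset.univ.filter fun e : I × J => A e.1 e.2 = true).map g
  have hE : ∀ u w, (u, w) ∈ E →
      ∃ i j, A i j = true ∧ u = Sum.inl j ∧ w = Sum.inr (Sum.inl i) := by
    intro u w h
    obtain ⟨e, he, heq⟩ := Finset.mem_map.1 h
    simp only [Finset.mem_filter, Finset.mem_univ, true_and] at he
    obtain ⟨h1, h2⟩ := Prod.mk.inj heq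
    exact ⟨e.1, e.2, he, h1.symm, h2.symm⟩
  have hend : ∀ i u, ¬ ((Sum.inr i, u) ∈ E) := by
    rintro i u h
    obtain ⟨_, _, _, h, _⟩ := hE _ _ h
    cases h
  refine ⟨⟨0, E, ?_⟩, ?_, ?_⟩
  · intro v hv
    obtain ⟨u, hu, -⟩ := Relation.TransGen.head'_iff.1 hv
    obtain ⟨w, -, hw⟩ := Relation.TransGen.tail'_iff.1 hv
    obtain ⟨_, _, _, h1, _⟩ := hE _ _ hu
    obtain ⟨_, _, _, _, h2⟩ := hE _ _ hw
    rw [h1] at h2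
    cases h2
  · intro i j
    constructor
    · intro h
      exact Relation.ReflTransGen.single (Finset.mem_map.2 ⟨(i, j), by simpa using h, rfl⟩)
    · intro h
      rcases Relation.ReflTransGen.cases_head h with h | ⟨u, hu, h⟩
      · cases h
      · obtain ⟨i', j', hij, h1, h2⟩ := hE _ _ hu
        rcases Relation.ReflTransGen.cases_head h with h | ⟨w, hw, -⟩
        · rw [h] at h2
          cases h1
          cases h2
          exact hij
        · rw [h2] at hw
          exact absurd hw (hend _ _)
  · simp only [Circuit.size, E, Finset.card_map, weight_eq_card]

/-- Some circuit exists, so the infimum in `OR` is attained and is not the default value 0 of `sInf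
∅`. -/
theorem exists_circuit_size_eq_OR (A : Matrix I J Bool) :
    ∃ S : Circuit I J, S.Implements A ∧ S.size = OR A := by
  obtain ⟨S, hS, -⟩ := exists_circuit A
  exact Nat.sInf_mem (s := {s : ℕ | ∃ S : Circuit I J, S.Implements A ∧ S.size = s})
    ⟨_, S, hS, rfl⟩

theorem OR_le_weight (A : Matrix I J Bool) : OR A ≤ weight A := by
  obtain ⟨S, hS, h⟩ := exists_circuit A
  exact h ▸ hS.OR_le

theorem weight_le_mul (A : Matrix I J Bool) : weight A ≤ Nat.card I * Nat.card J := by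
  have := Fintype.ofFinite I
  have := Fintype.ofFinite J
  rw [weight_eq_card, Nat.card_eq_fintype_card, Nat.card_eq_fintype_card, ← Fintype.card_prod]
  exact Finset.card_filter_le _ _

/-- If no row is zero, each output has an incoming edge. -/
theorem card_le_OR {A : Matrix I J Bool} (h : ∀ i, ∃ j, A i j = true) : Nat.card I ≤ OR A := by
  classical
  have := Fintype.ofFinite I
  obtain ⟨S, hS, hsize⟩ := exists_circuit_size_eq_OR A
  have hedge : ∀ i, ∃ u, (u, Sum.inr (Sum.inl i)) ∈ S.edges := by
    intro i
    obtain ⟨j, hj⟩ := h i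
    rcases Relation.ReflTransGen.cases_tail ((hS i j).1 hj) with h | ⟨u, -, hu⟩
    · cases h
    · exact ⟨u, hu⟩
  choose u hu using hedge
  rw [← hsize, Circuit.size, Nat.card_eq_fintype_card, ← Finset.card_univ]
  refine Finset.card_le_card_of_injOn (fun i => (u i, Sum.inr (Sum.inl i))) (fun i _ => hu i) ?_
  intro i _ i' _ hii
  simpa using (Prod.mk.inj hii).2

/-- The OR-complexity of a matrix without large all-ones submatrices is at least its weight, up to
a factor. -/
theorem weight_le_mul_OR {A : Matrix I J Bool} {k : ℕ} (hA : IsFree (k + 1) A) :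
    weight A ≤ (k * k + 2 * k) * OR A := by
  classical
  have := Fintype.ofFinite I
  have := Fintype.ofFinite J
  obtain ⟨S, hS, hsize⟩ := exists_circuit_size_eq_OR A
  let reach := Relation.ReflTransGen fun u w => (u, w) ∈ S.edges
  let inp : Vertex I J S.inner → Finset J := fun v => Finset.univ.filter fun j =>
    reach (Sum.inl j) v
  let out : Vertex I J S.inner → Finset I := fun v => Finset.univ.filter fun i =>
    reach v (Sum.inr (Sum.inl i))
  have hmem_inp : ∀ v j, j ∈ inp v ↔ reach (Sum.inl j) v := fun v j => by simp [inp]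
  have hmem_out : ∀ v i, i ∈ out v ↔ reach v (Sum.inr (Sum.inl i)) := fun v i => by simp [out]
  -- Inputs reaching `v` and outputs reached from `v` span an all-ones submatrix, so one of the two
  -- sets is small.
  have hsmall : ∀ v, ¬ (inp v).card ≤ k → (out v).card ≤ k := by
    intro v h1
    by_contra h2
    obtain ⟨Q, hQ, hQc⟩ := Finset.exists_subset_card_eq (not_le.1 h1)
    obtain ⟨P, hP, hPc⟩ := Finset.exists_subset_card_eq (not_le.1 h2)
    exact hA ⟨P, Q, hPc, hQc, fun i hi j hj => (hS i j).2
      (((hmem_inp v j).1 (hQ hj)).trans ((hmem_out v i).1 (hP hi)))⟩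
  -- Each one of the matrix is charged to an edge of a path realising it: to the edge where the
  -- number of reaching inputs first exceeds `k`, or to the first edge if it exceeds `k` at the
  -- start, or to the last edge if it is at most `k` at the end. The charges per edge are at most
  -- k², k and k. The case of a large start does occur, as inputs may have incoming edges.
  let T : Vertex I J S.inner × Vertex I J S.inner → Finset (I × J) := fun e =>
    (if (inp e.1).card ≤ k ∧ (out e.2).card ≤ k then out e.2 ×ˢ inp e.1 else ∅) ∪
      ((if (out e.1).card ≤ k then out e.1 else ∅) ×ˢ
        Finset.univ.filter fun j => Sum.inl j = e.1) ∪
      ((Finset.univ.filter fun i => Sum.inr (Sum.inl i) = e.2) ×ˢ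
        if (inp e.2).card ≤ k then inp e.2 else ∅)
  have hTcard : ∀ e, (T e).card ≤ k * k + 2 * k := by
    intro e
    have h1 : (if (inp e.1).card ≤ k ∧ (out e.2).card ≤ k then
        out e.2 ×ˢ inp e.1 else ∅).card ≤ k * k := by
      split_ifs with h
      · rw [Finset.card_product]
        exact Nat.mul_le_mul h.2 h.1
      · simp
    have h2 : ((if (out e.1).card ≤ k then out e.1 else ∅) ×ˢ
        Finset.univ.filter fun j : J => Sum.inl j = e.1).card ≤ k * 1 := by
      rw [Finset.card_product]
      refine Nat.mul_le_mul ?_ ?_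
      · split_ifs with h
        · exact h
        · simp
      · refine Finset.card_le_one.2 fun a ha b hb => ?_
        simp only [Finset.mem_filter, Finset.mem_univ, true_and] at ha hb
        exact Sum.inl_injective (ha.trans hb.symm)
    have h3 : ((Finset.univ.filter fun i : I => Sum.inr (Sum.inl i) = e.2) ×ˢ
        if (inp e.2).card ≤ k then inp e.2 else ∅).card ≤ 1 * k := by
      rw [Finset.card_product]
      refine Nat.mul_le_mul ?_ ?_
      · refine Finset.card_le_one.2 fun a ha b hb => ?_
        simp only [Finset.mem_filter, Finset.mem_univ, true_and] at ha hb
        exact Sum.inl_injective (Sum.inr_injective (ha.trans hb.symm))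
      · split_ifs with h
        · exact h
        · simp
    have h4 := Finset.card_union_le ((if (inp e.1).card ≤ k ∧ (out e.2).card ≤ k then
        out e.2 ×ˢ inp e.1 else ∅) ∪ ((if (out e.1).card ≤ k then out e.1 else ∅) ×ˢ
        Finset.univ.filter fun j : J => Sum.inl j = e.1))
      ((Finset.univ.filter fun i : I => Sum.inr (Sum.inl i) = e.2) ×ˢ
        if (inp e.2).card ≤ k then inp e.2 else ∅)
    have h5 := Finset.card_union_le (if (inp e.1).card ≤ k ∧ (out e.2).card ≤ k then
        out e.2 ×ˢ inp e.1 else ∅) ((if (out e.1).card ≤ k then out e.1 else ∅) ×ˢ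
        Finset.univ.filter fun j : J => Sum.inl j = e.1)
    have h6 : (T e).card ≤ _ := h4
    omega
  have hcross : ∀ u v, reach u v → (inp u).card ≤ k → ¬ (inp v).card ≤ k →
      ∃ x y, reach u x ∧ (x, y) ∈ S.edges ∧ reach y v ∧ (inp x).card ≤ k ∧
        ¬ (inp y).card ≤ k := by
    intro u v huv hu
    induction huv with
    | refl => exact fun h => absurd hu h
    | @tail y w huy hyw ih =>
      intro hw
      by_cases hy : (inp y).card ≤ k
      · exact ⟨y, w, huy, hyw, .refl, hy, hw⟩
      · obtain ⟨x, z, h1, h2, h3, h4⟩ := ih hy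
        exact ⟨x, z, h1, h2, h3.tail hyw, h4⟩
  have hcover : (Finset.univ.filter fun e : I × J => A e.1 e.2 = true) ⊆ S.edges.biUnion T := by
    rintro ⟨i, j⟩ hij
    simp only [Finset.mem_filter, Finset.mem_univ, true_and] at hij
    have hpath : reach (Sum.inl j) (Sum.inr (Sum.inl i)) := (hS i j).1 hij
    rw [Finset.mem_biUnion]
    by_cases hj : (inp (Sum.inl j)).card ≤ k
    · by_cases hi : (inp (Sum.inr (Sum.inl i))).card ≤ k
      · rcases Relation.ReflTransGen.cases_tail hpath with h | ⟨u, -, hu⟩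
        · cases h
        · refine ⟨_, hu, Finset.mem_union_right _ ?_⟩
          simp [hi, hmem_inp, hpath]
      · obtain ⟨x, y, h1, h2, h3, h4, h5⟩ := hcross _ _ hpath hj hi
        refine ⟨_, h2, Finset.mem_union_left _ (Finset.mem_union_left _ ?_)⟩
        simp [h4, hsmall y h5, hmem_inp, hmem_out, h1, h3]
    · rcases Relation.ReflTransGen.cases_head hpath with h | ⟨u, hu, -⟩
      · cases h
      · refine ⟨_, hu, Finset.mem_union_left _ (Finset.mem_union_right _ ?_)⟩
        simp [hsmall _ hj, hmem_out, hpath]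
  calc weight A ≤ (S.edges.biUnion T).card := by
        rw [weight_eq_card]
        exact Finset.card_le_card hcover
    _ ≤ S.edges.card * (k * k + 2 * k) := Finset.card_biUnion_le_card_mul _ _ _ fun e _ => hTcard e
    _ = (k * k + 2 * k) * OR A := by rw [← hsize, Circuit.size, mul_comm]

/-- A Boolean product of three matrices is implemented by a circuit with two inner layers. -/
theorem OR_le_of_product {K L : Type*} [Finite K] [Finite L] {A : Matrix I J Bool}
    (P : Matrix I K Bool) (M : Matrix K L Bool) (Q : Matrix L J Bool)
    (h : ∀ i j, A i j = true ↔ ∃ k l, P i k = true ∧ M k l = true ∧ Q l j = true) :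
    OR A ≤ weight P + weight M + weight Q := by
  classical
  have := Fintype.ofFinite I
  have := Fintype.ofFinite J
  have := Fintype.ofFinite K
  have := Fintype.ofFinite L
  let vK : K → J ⊕ (I ⊕ (K ⊕ L)) := fun k => Sum.inr (Sum.inr (Sum.inl k))
  let vL : L → J ⊕ (I ⊕ (K ⊕ L)) := fun l => Sum.inr (Sum.inr (Sum.inr l))
  let EP := (Finset.univ.filter fun e : I × K => P e.1 e.2 = true).image
    fun e => (vK e.2, (Sum.inr (Sum.inl e.1) : J ⊕ (I ⊕ (K ⊕ L))))
  let EM := (Finset.univ.filter fun e : K × L => M e.1 e.2 = true).image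
    fun e => (vL e.2, vK e.1)
  let EQ := (Finset.univ.filter fun e : L × J => Q e.1 e.2 = true).image
    fun e => ((Sum.inl e.2 : J ⊕ (I ⊕ (K ⊕ L))), vL e.1)
  let ht : J ⊕ (I ⊕ (K ⊕ L)) → ℕ :=
    Sum.elim (fun _ => 0) (Sum.elim (fun _ => 3) (Sum.elim (fun _ => 2) (fun _ => 1)))
  have hE : ∀ u w, (u, w) ∈ EP ∪ EM ∪ EQ →
      (∃ i k, P i k = true ∧ u = vK k ∧ w = Sum.inr (Sum.inl i)) ∨
      (∃ k l, M k l = true ∧ u = vL l ∧ w = vK k) ∨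
      (∃ l j, Q l j = true ∧ u = Sum.inl j ∧ w = vL l) := by
    intro u w huw
    simp only [EP, EM, EQ, Finset.mem_union, Finset.mem_image, Finset.mem_filter,
      Finset.mem_univ, true_and, Prod.exists, Prod.mk.injEq] at huw
    rcases huw with (⟨i, k, h, h1, h2⟩ | ⟨k, l, h, h1, h2⟩) | ⟨l, j, h, h1, h2⟩
    · exact Or.inl ⟨i, k, h, h1.symm, h2.symm⟩
    · exact Or.inr (Or.inl ⟨k, l, h, h1.symm, h2.symm⟩)
    · exact Or.inr (Or.inr ⟨l, j, h, h1.symm, h2.symm⟩)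
  refine (OR_le_card_of_height (EP ∪ EM ∪ EQ) ht ?_ ?_).trans ?_
  · rintro ⟨u, w⟩ huw
    rcases hE u w huw with ⟨i, k, -, rfl, rfl⟩ | ⟨k, l, -, rfl, rfl⟩ | ⟨l, j, -, rfl, rfl⟩ <;>
      simp [ht, vK, vL]
  · intro i j
    rw [h]
    constructor
    · rintro ⟨k, l, h1, h2, h3⟩
      have e1 : (Sum.inl j, vL l) ∈ EP ∪ EM ∪ EQ :=
        Finset.mem_union_right _ (Finset.mem_image.2 ⟨(l, j), by simpa using h3, rfl⟩)
      have e2 : (vL l, vK k) ∈ EP ∪ EM ∪ EQ := Finset.mem_union_left _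
        (Finset.mem_union_right _ (Finset.mem_image.2 ⟨(k, l), by simpa using h2, rfl⟩))
      have e3 : (vK k, Sum.inr (Sum.inl i)) ∈ EP ∪ EM ∪ EQ := Finset.mem_union_left _
        (Finset.mem_union_left _ (Finset.mem_image.2 ⟨(i, k), by simpa using h1, rfl⟩))
      exact ((Relation.ReflTransGen.single e1).tail e2).tail e3
    · intro hr
      let good : J ⊕ (I ⊕ (K ⊕ L)) → Prop := fun v =>
        v = Sum.inl j ∨ (∃ l, v = vL l ∧ Q l j = true) ∨
        (∃ k l, v = vK k ∧ M k l = true ∧ Q l j = true) ∨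
        ∃ i k l, v = Sum.inr (Sum.inl i) ∧ P i k = true ∧ M k l = true ∧ Q l j = true
      have hgood : ∀ v, Relation.ReflTransGen (fun u w => (u, w) ∈ EP ∪ EM ∪ EQ) (Sum.inl j) v →
          good v := by
        intro v hv
        induction hv with
        | refl => exact Or.inl rfl
        | @tail u w _ huw ih =>
          rcases hE u w huw with ⟨i, k, h0, rfl, rfl⟩ | ⟨k, l, h0, rfl, rfl⟩ | ⟨l, j', h0, rfl, rfl⟩
          · rcases ih with h | ⟨l, h, -⟩ | ⟨k', l, h, h1, h2⟩ | ⟨i', k', l, h, -⟩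
            · cases h
            · cases h
            · cases h
              exact Or.inr (Or.inr (Or.inr ⟨i, k, l, rfl, h0, h1, h2⟩))
            · cases h
          · rcases ih with h | ⟨l', h, h1⟩ | ⟨k', l', h, h1, h2⟩ | ⟨i', k', l', h, -⟩
            · cases h
            · cases h
              exact Or.inr (Or.inr (Or.inl ⟨k, l, rfl, h0, h1⟩))
            · cases h
            · cases h
          · rcases ih with h | ⟨l', h, h1⟩ | ⟨k', l', h, h1, h2⟩ | ⟨i', k', l', h, -⟩
            · cases h
              exact Or.inr (Or.inl ⟨l, rfl, h0⟩)
            · cases h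
            · cases h
            · cases h
      rcases hgood _ hr with h | ⟨l', h, h1⟩ | ⟨k', l', h, h1, h2⟩ | ⟨i', k', l', h, h1⟩
      · cases h
      · cases h
      · cases h
      · cases h
        exact ⟨k', l', h1⟩
  · refine (Finset.card_union_le _ _).trans (Nat.add_le_add
      ((Finset.card_union_le _ _).trans (Nat.add_le_add ?_ ?_)) ?_) <;>
    · rw [weight_eq_card]
      exact Finset.card_image_le

end Circuits

theorem compl_compl {I J : Type*} (A : Matrix I J Bool) : compl (compl A) = A := by
  ext i j
  simp [compl]

/-! ### Weights of matrices -/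

section Weights

variable {I J : Type*}

theorem weight_transpose (A : Matrix I J Bool) : weight A.transpose = weight A := by
  unfold weight
  rw [← Set.ncard_image_of_injective _ (Prod.swap_injective (α := I) (β := J))]
  congr 1
  ext ⟨j, i⟩
  simp [Matrix.transpose_apply]

theorem weight_le_of_rows [Finite I] [Finite J] {A : Matrix I J Bool} {c : ℕ}
    (h : ∀ i, ∃ s : Finset J, s.card ≤ c ∧ ∀ j, A i j = true → j ∈ s) :
    weight A ≤ Nat.card I * c := by
  classical
  have := Fintype.ofFinite I
  have := Fintype.ofFinite J
  choose s hs hA using h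
  rw [weight_eq_card, Nat.card_eq_fintype_card, ← Finset.card_univ]
  calc (Finset.univ.filter fun e : I × J => A e.1 e.2 = true).card
      ≤ (Finset.univ.sigma s).card := by
        refine Finset.card_le_card_of_injOn (fun e => ⟨e.1, e.2⟩) ?_ ?_
        · rintro ⟨i, j⟩ he
          simp only [Finset.coe_filter, Finset.mem_univ, true_and, Set.mem_ofPred_eq] at he
          simpa using hA i j he
        · rintro ⟨i, j⟩ _ ⟨i', j'⟩ _ h
          simpa using h
    _ = ∑ i, (s i).card := Finset.card_sigma _ _
    _ ≤ Finset.univ.card * c := by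
        rw [← smul_eq_mul, ← Finset.sum_const]
        exact Finset.sum_le_sum fun i _ => hs i

end Weights

/-! ### 2-rectangle matrices: freeness, and cheap complements -/

section Rectangles

variable {V : Type*}

theorem card_padIndex [Finite V] {n : ℕ} (h : (Nat.card V).choose 2 ≤ n) : Nat.card (PadIndex V n) = n := by
  classical
  have := Fintype.ofFinite V
  rw [Nat.card_sum, Nat.card_eq_fintype_card (α := Pairs V), Fintype.card_finset_len, Nat.card_fin,
    ← Nat.card_eq_fintype_card]
  omega

/-- The set of labels that belongs to a row or column of the padded matrix. -/
def padSet {n : ℕ} : PadIndex V n → Finset V :=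
  Sum.elim Subtype.val fun _ => ∅

theorem padRect_eq_true {A : Matrix V V Bool} {n : ℕ} {a b : PadIndex V n}
    (h : padRect A n a b = true) :
    (padSet a).card = 2 ∧ (padSet b).card = 2 ∧ ∀ i ∈ padSet a, ∀ j ∈ padSet b, A i j = true := by
  rcases a with a | a <;> rcases b with b | b <;> simp [padRect, rectMatrix] at h
  exact ⟨a.2, b.2, h⟩

theorem card_le_choose_padSet [DecidableEq V] {n : ℕ} (R : Finset (PadIndex V n))
    (hR : ∀ a ∈ R, (padSet a).card = 2) : R.card ≤ (R.biUnion padSet).card.choose 2 := by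
  rw [← Finset.card_powersetCard]
  refine Finset.card_le_card_of_injOn padSet ?_ ?_
  · intro a ha
    exact Finset.mem_powersetCard.2 ⟨Finset.subset_biUnion_of_mem padSet ha, hR a ha⟩
  · intro a ha b hb hab
    have ha2 := hR a ha
    have hb2 := hR b hb
    rcases a with a | a <;> rcases b with b | b
    · exact congrArg Sum.inl (Subtype.ext hab)
    all_goals simp [padSet] at ha2 hb2

/-- All-ones submatrices of the 2-rectangle matrix give all-ones submatrices of the matrix. -/
theorem isFree_padRect {A : Matrix V V Bool} {r : ℕ} (hA : IsFree (r + 1) A) (n : ℕ) :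
    IsFree (r.choose 2 + 1) (padRect A n) := by
  classical
  rintro ⟨R, S, hR, hS, hRS⟩
  obtain ⟨a₀, ha₀⟩ := Finset.card_pos.1 (by rw [hR]; exact Nat.succ_pos _)
  obtain ⟨b₀, hb₀⟩ := Finset.card_pos.1 (by rw [hS]; exact Nat.succ_pos _)
  -- Only `r.choose 2` pairs fit into r elements, so one more pair forces r + 1 elements. The labels
  -- involved are genuine pairs, since padding rows and columns are zero.
  have hlarge : ∀ T : Finset (PadIndex V n), T.card = r.choose 2 + 1 →
      (∀ a ∈ T, (padSet a).card = 2) → r + 1 ≤ (T.biUnion padSet).card := by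
    intro T hT h2
    by_contra! hlt
    have h1 := card_le_choose_padSet T h2
    have h3 := Nat.choose_le_choose 2 (Nat.le_of_lt_succ hlt)
    omega
  obtain ⟨R', hR', hR'c⟩ := Finset.exists_subset_card_eq
    (hlarge R hR fun a ha => (padRect_eq_true (hRS a ha b₀ hb₀)).1)
  obtain ⟨S', hS', hS'c⟩ := Finset.exists_subset_card_eq
    (hlarge S hS fun b hb => (padRect_eq_true (hRS a₀ ha₀ b hb)).2.1)
  refine hA ⟨R', S', hR'c, hS'c, fun i hi j hj => ?_⟩
  obtain ⟨a, ha, hia⟩ := Finset.mem_biUnion.1 (hR' hi)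
  obtain ⟨b, hb, hjb⟩ := Finset.mem_biUnion.1 (hS' hj)
  exact (padRect_eq_true (hRS a ha b hb)).2.2 i hia j hjb

open scoped Classical in
/-- The incidence matrix of the labels of the padded matrix and the elements of `V`; the additional
labels are incident with `none`. -/
noncomputable def padIncidence (V : Type*) (n : ℕ) : Matrix (PadIndex V n) (Option V) Bool :=
  Matrix.of fun a k => decide (a.elim (fun a => ∃ i ∈ a.1, k = some i) fun _ => k = none)

theorem padIncidence_inl {n : ℕ} (a : Pairs V) (k : Option V) :
    padIncidence V n (Sum.inl a) k = true ↔ ∃ i ∈ a.1, k = some i := by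
  classical
  exact decide_eq_true_iff

theorem padIncidence_inr {n : ℕ} (a) (k : Option V) :
    padIncidence V n (Sum.inr a) k = true ↔ k = none := by
  classical
  exact decide_eq_true_iff

theorem weight_padIncidence_le [Finite V] {n : ℕ} (h : (Nat.card V).choose 2 ≤ n) :
    weight (padIncidence V n) ≤ n * 2 := by
  classical
  have := weight_le_of_rows (A := padIncidence V n) (c := 2) ?_
  · rwa [card_padIndex h] at this
  · rintro (a | a)
    · refine ⟨a.1.image some, Finset.card_image_le.trans a.2.le, fun k hk => ?_⟩
      obtain ⟨i, hi, rfl⟩ := (padIncidence_inl a k).1 hk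
      exact Finset.mem_image_of_mem _ hi
    · refine ⟨{none}, by simp, fun k hk => ?_⟩
      simpa [padIncidence_inr] using hk

/-- The complement of the padded 2-rectangle matrix has linear OR-complexity. -/
theorem OR_compl_padRect_le [Finite V] (A : Matrix V V Bool) {n : ℕ} (hV : 2 ≤ Nat.card V)
    (h : (Nat.card V).choose 2 ≤ n) : OR (compl (padRect A n)) ≤ 13 * n := by
  classical
  -- The complement of `A`, bordered by an all-ones row and column at `none`. These serve the
  -- padding labels, whose rows and columns in the complement are all ones.
  let M : Matrix (Option V) (Option V) Bool := Matrix.of fun k l =>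
    decide (∀ i j, k = some i → l = some j → A i j = false)
  have hprod := OR_le_of_product (A := compl (padRect A n)) (padIncidence V n) M
    (padIncidence V n).transpose ?_
  · refine hprod.trans ?_
    have h1 := weight_padIncidence_le (V := V) h
    have h2 := weight_le_mul M
    rw [weight_transpose]
    rw [Finite.card_option] at h2
    set m := Nat.card V
    -- Equality holds at m = 2. The total is 2n + 9n + 2n = 13n.
    have h3 : (m + 1) * (m + 1) ≤ 9 * m.choose 2 := by
      have h4 := Nat.choose_two_right m
      have h5 : 2 ∣ m * (m - 1) := (Nat.even_mul_pred_self m).two_dvd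
      obtain ⟨c, hc⟩ := h5
      rw [hc, Nat.mul_div_cancel_left _ two_pos] at h4
      obtain ⟨k, hk⟩ := Nat.exists_eq_add_of_le hV
      rw [h4]
      rw [hk, show 2 + k - 1 = k + 1 by omega] at hc
      rw [hk]
      nlinarith
    omega
  · have hne : ∀ a : Pairs V, ∃ i, i ∈ a.1 := fun a =>
      Finset.card_pos.1 (by rw [a.2]; exact two_pos)
    intro a b
    rcases a with a | a <;> rcases b with b | b
    · simp only [compl, padRect, rectMatrix, padIncidence_inl, M, Matrix.of_apply,
        Matrix.transpose_apply, decide_eq_true_eq, Bool.not_eq_true',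
        decide_eq_false_iff_not, not_forall, Bool.not_eq_true]
      constructor
      · rintro ⟨i, hi, j, hj, hij⟩
        refine ⟨some i, some j, ⟨i, hi, rfl⟩, ?_, ⟨j, hj, rfl⟩⟩
        intro i' j' h1 h2
        cases h1
        cases h2
        exact hij
      · rintro ⟨_, _, ⟨i, hi, rfl⟩, hM, ⟨j, hj, rfl⟩⟩
        exact ⟨i, hi, j, hj, hM i j rfl rfl⟩
    · obtain ⟨i, hi⟩ := hne a
      simp only [compl, padRect, Matrix.of_apply, Bool.not_false, true_iff]
      exact ⟨some i, none, (padIncidence_inl a _).2 ⟨i, hi, rfl⟩, by simp [M], (padIncidence_inr b _).2 rfl⟩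
    · obtain ⟨j, hj⟩ := hne b
      simp only [compl, padRect, Matrix.of_apply, Bool.not_false, true_iff]
      exact ⟨none, some j, (padIncidence_inr a _).2 rfl, by simp [M], (padIncidence_inl b _).2 ⟨j, hj, rfl⟩⟩
    · simp only [compl, padRect, Matrix.of_apply, Bool.not_false, true_iff]
      exact ⟨none, none, (padIncidence_inr a _).2 rfl, by simp [M], (padIncidence_inr b _).2 rfl⟩

end Rectangles

/-! ### Counting all-ones 2 × 2 submatrices -/

section Counting

variable {V : Type*} [Fintype V] [Nonempty V]

/-- The number of pairs of rows and columns, possibly equal, that span an all-ones submatrix of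
a regular matrix. -/
theorem pow_four_le_sum_sq {A : Matrix V V Bool} {d : ℕ}
    (hcol : ∀ j, (Finset.univ.filter fun i => A i j = true).card = d) :
    ∑ p : V × V, (Finset.univ.filter fun j => A p.1 j = true ∧ A p.2 j = true).card =
        Fintype.card V * d ^ 2 ∧
      d ^ 4 ≤ ∑ p : V × V,
        (Finset.univ.filter fun j => A p.1 j = true ∧ A p.2 j = true).card ^ 2 := by
  have hsum : ∑ p : V × V,
      (Finset.univ.filter fun j => A p.1 j = true ∧ A p.2 j = true).card =
      Fintype.card V * d ^ 2 := by
    simp_rw [Finset.card_filter]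
    rw [Finset.sum_comm]
    have : ∀ j, (∑ p : V × V, if A p.1 j = true ∧ A p.2 j = true then 1 else 0) = d ^ 2 := by
      intro j
      rw [← Finset.card_filter, ← Finset.univ_product_univ, Finset.filter_product
        (fun i => A i j = true) (fun i => A i j = true), Finset.card_product, hcol, sq]
    simp_rw [this]
    simp
  refine ⟨hsum, ?_⟩
  have hcs := sq_sum_le_card_mul_sum_sq (s := (Finset.univ : Finset (V × V)))
    (f := fun p => (Finset.univ.filter fun j => A p.1 j = true ∧ A p.2 j = true).card)
  rw [hsum, Finset.card_univ, Fintype.card_prod] at hcs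
  have h0 : 0 < Fintype.card V := Fintype.card_pos
  refine Nat.le_of_mul_le_mul_left ?_ (Nat.mul_pos h0 h0)
  calc Fintype.card V * Fintype.card V * d ^ 4 = (Fintype.card V * d ^ 2) ^ 2 := by ring
    _ ≤ _ := by exact_mod_cast hcs

/-- A dense regular matrix contains many all-ones `2 × 2` submatrices. -/
theorem pow_four_le_weight_padRect {A : Matrix V V Bool} {d : ℕ}
    (hrow : ∀ i, (Finset.univ.filter fun j => A i j = true).card = d)
    (hcol : ∀ j, (Finset.univ.filter fun i => A i j = true).card = d)
    (hd : 4 * Fintype.card V ≤ d ^ 2) (n : ℕ) :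
    d ^ 4 ≤ 32 * weight (padRect A n) := by
  classical
  let N : V × V → Finset V := fun p =>
    Finset.univ.filter fun j => A p.1 j = true ∧ A p.2 j = true
  let Q : Finset ((_ : V × V) × (V × V)) :=
    (Finset.univ.filter fun p : V × V => p.1 ≠ p.2).sigma fun p => (N p).offDiag
  obtain ⟨hsum, hsq⟩ := pow_four_le_sum_sq hcol
  change ∑ p, (N p).card = _ at hsum
  change _ ≤ ∑ p, (N p).card ^ 2 at hsq
  have hdiag : ∑ p ∈ Finset.univ.filter (fun p : V × V => ¬ p.1 ≠ p.2), (N p).card ^ 2 =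
      Fintype.card V * d ^ 2 := by
    have : (Finset.univ.filter fun p : V × V => ¬ p.1 ≠ p.2) =
        Finset.univ.image fun i => (i, i) := by
      ext ⟨i, j⟩
      simp
    rw [this, Finset.sum_image (fun i _ j _ h => (Prod.mk.inj h).1)]
    simp [N, hrow]
  -- Two terms must be removed from the sum of squares: the pairs of equal rows and the pairs of
  -- equal columns. Each is at most |V|d² ≤ d⁴/4, so half of d⁴ remains.
  have hQ : d ^ 4 ≤ 2 * Q.card := by
    have h1 : Q.card + ∑ p ∈ Finset.univ.filter (fun p : V × V => p.1 ≠ p.2), (N p).card =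
        ∑ p ∈ Finset.univ.filter (fun p : V × V => p.1 ≠ p.2), (N p).card ^ 2 := by
      rw [Finset.card_sigma, ← Finset.sum_add_distrib]
      refine Finset.sum_congr rfl fun p _ => ?_
      rw [Finset.offDiag_card, sq, Nat.sub_add_cancel (Nat.le_mul_self _)]
    have h2 : ∑ p ∈ Finset.univ.filter (fun p : V × V => p.1 ≠ p.2), (N p).card ≤
        Fintype.card V * d ^ 2 := by
      rw [← hsum]
      exact Finset.sum_le_sum_of_subset (Finset.filter_subset _ _)
    have h3 := Finset.sum_filter_add_sum_filter_not Finset.univ (fun p : V × V => p.1 ≠ p.2)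
      fun p => (N p).card ^ 2
    have h4 : 4 * (Fintype.card V * d ^ 2) ≤ d ^ 4 := by
      calc 4 * (Fintype.card V * d ^ 2) = (4 * Fintype.card V) * d ^ 2 := by ring
        _ ≤ d ^ 2 * d ^ 2 := Nat.mul_le_mul_right _ hd
        _ = d ^ 4 := by ring
    omega
  let f : ((_ : V × V) × (V × V)) → Finset V × Finset V := fun x =>
    ({x.1.1, x.1.2}, {x.2.1, x.2.2})
  let O := Finset.univ.filter fun e : PadIndex V n × PadIndex V n => padRect A n e.1 e.2 = true
  have hsub : Q.image f ⊆ O.image fun e => (padSet e.1, padSet e.2) := by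
    intro y hy
    obtain ⟨⟨⟨i, i'⟩, ⟨j, j'⟩⟩, hx, rfl⟩ := Finset.mem_image.1 hy
    simp only [Q, N, Finset.mem_sigma, Finset.mem_filter, Finset.mem_univ, true_and,
      Finset.mem_offDiag] at hx
    obtain ⟨hi, ⟨h1, h2⟩, ⟨h3, h4⟩, hj⟩ := hx
    refine Finset.mem_image.2 ⟨(Sum.inl ⟨{i, i'}, Finset.card_pair hi⟩,
      Sum.inl ⟨{j, j'}, Finset.card_pair hj⟩), ?_, rfl⟩
    refine Finset.mem_filter.2 ⟨Finset.mem_univ _, ?_⟩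
    simp [padRect, rectMatrix, h1, h2, h3, h4]
  -- A crude bound on the orderings of a rectangle: 2² pairs for the rows times 2² for the columns.
  -- With the factor 2 of `hQ` it gives 32.
  have hfib : ∀ y ∈ Q.image f, (Q.filter fun x => f x = y).card ≤ 16 := by
    intro y hy
    obtain ⟨x, -, rfl⟩ := Finset.mem_image.1 hy
    have hsub : (Q.filter fun x' => f x' = f x) ⊆
        ((f x).1 ×ˢ (f x).1).sigma fun _ => (f x).2 ×ˢ (f x).2 := by
      intro x' hx'
      have hx' := (Finset.mem_filter.1 hx').2
      rw [← hx']
      simp [f]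
    refine (Finset.card_le_card hsub).trans ?_
    rw [Finset.card_sigma, Finset.sum_const, smul_eq_mul, Finset.card_product,
      Finset.card_product]
    have h1 : (f x).1.card ≤ 2 := Finset.card_le_two
    have h2 : (f x).2.card ≤ 2 := Finset.card_le_two
    calc _ ≤ (2 * 2) * (2 * 2) :=
          Nat.mul_le_mul (Nat.mul_le_mul h1 h1) (Nat.mul_le_mul h2 h2)
      _ = 16 := rfl
  have h1 := Finset.card_le_mul_card_image Q 16 hfib
  have h2 : (Q.image f).card ≤ weight (padRect A n) := by
    rw [weight_eq_card]
    exact (Finset.card_le_card hsub).trans Finset.card_image_le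
  omega

end Counting

/-! ### Elementary bounds for binomial coefficients -/

section ChooseTwo

theorem two_mul_choose_two (m : ℕ) : 2 * (m + 1).choose 2 = (m + 1) * m := by
  rw [Nat.choose_two_right, Nat.add_sub_cancel]
  exact Nat.mul_div_cancel' (by simpa using (Nat.even_mul_pred_self (m + 1)).two_dvd)

theorem choose_two_le_sq (m : ℕ) : m.choose 2 ≤ m ^ 2 := by
  rcases m with _ | m
  · simp
  · have := two_mul_choose_two m
    nlinarith

theorem sq_le_four_mul_choose_two {m : ℕ} (hm : 2 ≤ m) : m ^ 2 ≤ 4 * m.choose 2 := by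
  obtain ⟨k, rfl⟩ := Nat.exists_eq_add_of_le' (show 1 ≤ m by omega)
  have := two_mul_choose_two k
  have hk : 1 ≤ k := by omega
  nlinarith

theorem le_choose_two {m : ℕ} (hm : 3 ≤ m) : m ≤ m.choose 2 := by
  obtain ⟨k, rfl⟩ := Nat.exists_eq_add_of_le' (show 1 ≤ m by omega)
  have := two_mul_choose_two k
  have hk : 2 ≤ k := by omega
  nlinarith

end ChooseTwo

/-! ### Spheres in affine 3-space -/

section Sphere

variable {F : Type*} [Field F]

/-- An isotropic vector orthogonal to a vector of length `α` vanishes unless `-α` is a square. -/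
theorem eq_zero_of_isotropic {α : F} (hα : ¬ IsSquare (-α)) {w u : Fin 3 → F}
    (hw : ∑ i, w i ^ 2 = α) (hwu : ∑ i, w i * u i = 0) (hu : ∑ i, u i ^ 2 = 0) : u = 0 := by
  simp only [Fin.sum_univ_three] at hw hwu hu
  -- By Lagrange's identity, each coordinate of the cross product of `w` and `u` has square -α uᵢ².
  -- A nonzero uᵢ would therefore make -α a square.
  have key : ∀ a b : F, a ≠ 0 → b ^ 2 = -α * a ^ 2 → False := by
    intro a b ha h
    refine hα ⟨b / a, ?_⟩
    field_simp
    linear_combination -h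
  funext i
  by_contra hi
  fin_cases i
  · refine key _ (w 1 * u 2 - w 2 * u 1) hi ?_
    simp only [Fin.zero_eta, Fin.isValue]
    linear_combination (w 1 ^ 2 + w 2 ^ 2) * hu - u 0 ^ 2 * hw -
      (w 1 * u 1 + w 2 * u 2 - w 0 * u 0) * hwu
  · refine key _ (w 0 * u 2 - w 2 * u 0) hi ?_
    simp only [Fin.mk_one, Fin.isValue]
    linear_combination (w 0 ^ 2 + w 2 ^ 2) * hu - u 1 ^ 2 * hw -
      (w 0 * u 0 + w 2 * u 2 - w 1 * u 1) * hwu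
  · refine key _ (w 0 * u 1 - w 1 * u 0) hi ?_
    simp only [Fin.reduceFinMk, Fin.isValue]
    linear_combination (w 0 ^ 2 + w 1 ^ 2) * hu - u 2 ^ 2 * hw -
      (w 0 * u 0 + w 1 * u 1 - w 2 * u 2) * hwu

/-- A line has at most two points on the sphere. -/
theorem not_three_collinear {α : F} (h2 : (2 : F) ≠ 0) (hα : ¬ IsSquare (-α))
    {x x₁ x₂ x₃ : Fin 3 → F} (h₁ : ∑ i, (x₁ i - x i) ^ 2 = α) (h₂ : ∑ i, (x₂ i - x i) ^ 2 = α)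
    (h₃ : ∑ i, (x₃ i - x i) ^ 2 = α) (h₁₂ : x₂ ≠ x₁) (h₁₃ : x₃ ≠ x₁) (h₂₃ : x₃ ≠ x₂) {c : F}
    (hc : ∀ i, x₃ i - x₁ i = c * (x₂ i - x₁ i)) : False := by
  have hc0 : c ≠ 0 := by
    rintro rfl
    exact h₁₃ (funext fun i => sub_eq_zero.1 (by rw [hc i, zero_mul]))
  have hc1 : c - 1 ≠ 0 := by
    intro h
    refine h₂₃ (funext fun i => ?_)
    linear_combination hc i + h * (x₂ i - x₁ i)
  -- Along the line the sphere equation is quadratic in the parameter and has the three distinct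
  -- roots 0, 1 and c. So its leading coefficient vanishes, and then its linear one (`hwu`).
  have hu : ∑ i, (x₂ i - x₁ i) ^ 2 = 0 := by
    refine (mul_eq_zero.1 ?_).resolve_left (mul_ne_zero hc0 hc1)
    have h3 : ∀ i, x₃ i = x₁ i + c * (x₂ i - x₁ i) := fun i => by linear_combination hc i
    simp only [h3] at h₃
    simp only [Fin.sum_univ_three] at h₁ h₂ h₃ ⊢
    linear_combination h₃ - h₁ - c * (h₂ - h₁)
  have hwu : ∑ i, (x₁ i - x i) * (x₂ i - x₁ i) = 0 := by
    refine (mul_eq_zero.1 ?_).resolve_left h2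
    simp only [Fin.sum_univ_three] at h₁ h₂ hu ⊢
    linear_combination h₂ - h₁ - hu
  have := eq_zero_of_isotropic hα (w := fun i => x₁ i - x i) (u := fun i => x₂ i - x₁ i) h₁ hwu hu
  exact h₁₂ (funext fun i => sub_eq_zero.1 (congrFun this i))

theorem exists_eq_mul_of_parallel {u z : Fin 3 → F} (hz : z ≠ 0)
    (h : ∀ i j, u i * z j = u j * z i) : ∃ c, ∀ i, u i = c * z i := by
  obtain ⟨k, hk⟩ := Function.ne_iff.1 hz
  rw [Pi.zero_apply] at hk
  refine ⟨u k / z k, fun i => ?_⟩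
  have := h i k
  field_simp
  exact this

/-- A vector orthogonal to two vectors is parallel to their cross product. -/
theorem parallel_cross {u v v' : Fin 3 → F} (h : ∑ i, u i * v i = 0) (h' : ∑ i, u i * v' i = 0)
    (i j : Fin 3) : u i * crossProduct v v' j = u j * crossProduct v v' i := by
  simp only [Fin.sum_univ_three] at h h'
  rw [cross_apply]
  fin_cases i <;> fin_cases j <;> simp
  · linear_combination v 2 * h' - v' 2 * h
  · linear_combination -v 1 * h' + v' 1 * h
  · linear_combination -v 2 * h' + v' 2 * h
  · linear_combination v 0 * h' - v' 0 * h
  · linear_combination v 1 * h' - v' 1 * h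
  · linear_combination -v 0 * h' + v' 0 * h

/-- Three distinct points have at most two common neighbours with respect to the spheres of
length `α`. -/
theorem not_three_three {α : F} (h2 : (2 : F) ≠ 0) (hα : ¬ IsSquare (-α))
    {x y : Fin 3 → Fin 3 → F} (hx : Function.Injective x) (hy : Function.Injective y)
    (h : ∀ k l, ∑ i, (x k i - y l i) ^ 2 = α) : False := by
  have hyx : ∀ k l, ∑ i, (y l i - x k i) ^ 2 = α := fun k l => by
    rw [← h k l]
    exact Finset.sum_congr rfl fun i _ => by ring
  -- Subtracting the equations pairwise makes the differences of the x's orthogonal to those of the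
  -- y's. So either the y's are collinear or the x's all lie on a line along the cross product; both
  -- contradict `not_three_collinear`.
  have horth : ∀ k l, ∑ i, (x k i - x 0 i) * (y l i - y 0 i) = 0 := by
    intro k l
    refine (mul_eq_zero.1 ?_).resolve_left h2
    have h1 := h k l
    have h2 := h k 0
    have h3 := h 0 l
    have h4 := h 0 0
    simp only [Fin.sum_univ_three] at h1 h2 h3 h4 ⊢
    linear_combination -h1 + h2 + h3 - h4
  have hx' : ∀ k l, k ≠ l → x k ≠ x l := fun k l hkl => hx.ne hkl
  have hy' : ∀ k l, k ≠ l → y k ≠ y l := fun k l hkl => hy.ne hkl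
  let v : Fin 3 → Fin 3 → F := fun l i => y l i - y 0 i
  let u : Fin 3 → Fin 3 → F := fun k i => x k i - x 0 i
  by_cases hz : crossProduct (v 1) (v 2) = 0
  · have hv : v 1 ≠ 0 := fun h0 => hy' 1 0 (by decide) (funext fun i =>
      sub_eq_zero.1 (congrFun h0 i))
    obtain ⟨c, hc⟩ := exists_eq_mul_of_parallel (u := v 2) hv (by
      have e0 := congrFun hz 0
      have e1 := congrFun hz 1
      have e2 := congrFun hz 2
      simp only [cross_apply, Matrix.cons_val, Pi.zero_apply] at e0 e1 e2
      intro i j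
      fin_cases i <;> fin_cases j <;> simp
      · linear_combination -e2
      · linear_combination e1
      · linear_combination e2
      · linear_combination -e0
      · linear_combination -e1
      · linear_combination e0)
    exact not_three_collinear h2 hα (hyx 0 0) (hyx 0 1) (hyx 0 2) (hy' 1 0 (by decide))
      (hy' 2 0 (by decide)) (hy' 2 1 (by decide)) hc
  · obtain ⟨c, hc⟩ := exists_eq_mul_of_parallel (u := u 1) hz
      (parallel_cross (horth 1 1) (horth 1 2))
    obtain ⟨c', hc'⟩ := exists_eq_mul_of_parallel (u := u 2) hz
      (parallel_cross (horth 2 1) (horth 2 2))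
    have hc0 : c ≠ 0 := by
      rintro rfl
      exact hx' 1 0 (by decide) (funext fun i => sub_eq_zero.1 ((hc i).trans (zero_mul _)))
    refine not_three_collinear h2 hα (h 0 0) (h 1 0) (h 2 0) (hx' 1 0 (by decide))
      (hx' 2 0 (by decide)) (hx' 2 1 (by decide)) (c := c' / c) fun i => ?_
    have e1 : x 1 i - x 0 i = _ := hc i
    have e2 : x 2 i - x 0 i = _ := hc' i
    rw [e1, e2]
    field_simp

end Sphere

/-! ### Brown's matrix: freeness and degree -/

section Brown

variable (p : ℕ) [Fact p.Prime]

theorem two_ne_zero_zmod (hp : 2 < p) : (2 : ZMod p) ≠ 0 := by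
  intro h
  have h' : ((2 : ℕ) : ZMod p) = 0 := by exact_mod_cast h
  rw [ZMod.natCast_eq_zero_iff] at h'
  exact absurd (Nat.le_of_dvd two_pos h') (by omega)

theorem not_isSquare_neg_brownAlpha (hp : 2 < p) : ¬ IsSquare (-(brownAlpha p : ZMod p)) := by
  have hne : {a : ℕ | ¬ IsSquare (-(a : ZMod p))}.Nonempty := by
    obtain ⟨a, ha⟩ := FiniteField.exists_nonsquare (F := ZMod p) (by
      rw [ZMod.ringChar_zmod_n]; omega)
    refine ⟨(-a).val, ?_⟩
    simpa using ha
  exact Nat.sInf_mem hne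

theorem isFree_brownMatrix (hp : 2 < p) : IsFree 3 (brownMatrix p) := by
  rintro ⟨R, S, hR, hS, hRS⟩
  let x := (R.equivFinOfCardEq hR).symm
  let y := (S.equivFinOfCardEq hS).symm
  refine not_three_three (two_ne_zero_zmod p hp) (not_isSquare_neg_brownAlpha p hp)
    (x := fun k => (x k).1) (y := fun k => (y k).1)
    (Subtype.val_injective.comp x.injective) (Subtype.val_injective.comp y.injective)
    fun k l => ?_
  have := hRS _ (x k).2 _ (y l).2
  simpa [brownMatrix] using this

theorem card_sq_eq_le (c : ZMod p) : (Finset.univ.filter fun z : ZMod p => z ^ 2 = c).card ≤ 2 := by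
  by_cases h : ∃ z₀ : ZMod p, z₀ ^ 2 = c
  · obtain ⟨z₀, rfl⟩ := h
    refine (Finset.card_le_card (t := {z₀, -z₀}) fun z hz => ?_).trans Finset.card_le_two
    simpa [sq_eq_sq_iff_eq_or_eq_neg] using hz
  · rw [Finset.filter_false_of_mem fun z _ hz => h ⟨z, hz⟩]
    simp

/-- The number of points of a circle in the plane over the integers modulo `p`. -/
def circleCard (c : ZMod p) : ℕ :=
  (Finset.univ.filter fun z : ZMod p × ZMod p => z.1 ^ 2 + z.2 ^ 2 = c).card

/-- Multiplication by a + bi with a² + b² = c/c' maps one circle injectively into the other. By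
symmetry all circles of nonzero length have equally many points. -/
theorem circleCard_le {c c' : ZMod p} (hc : c ≠ 0) (hc' : c' ≠ 0) :
    circleCard p c' ≤ circleCard p c := by
  obtain ⟨a, b, hab⟩ := ZMod.sq_add_sq p (c / c')
  have h0 : a ^ 2 + b ^ 2 ≠ 0 := hab ▸ div_ne_zero hc hc'
  refine Finset.card_le_card_of_injOn
    (fun z => (a * z.1 - b * z.2, b * z.1 + a * z.2)) ?_ ?_
  · rintro ⟨x, y⟩ hz
    simp only [Finset.coe_filter, Finset.mem_univ, true_and, Set.mem_ofPred_eq] at hz ⊢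
    calc (a * x - b * y) ^ 2 + (b * x + a * y) ^ 2 = (a ^ 2 + b ^ 2) * (x ^ 2 + y ^ 2) := by ring
      _ = c := by rw [hab, hz, div_mul_cancel₀ _ hc']
  · rintro ⟨x, y⟩ - ⟨x', y'⟩ - h
    simp only [Prod.mk.injEq] at h
    obtain ⟨h1, h2⟩ := h
    ext
    · exact mul_left_cancel₀ h0 (by linear_combination a * h1 + b * h2)
    · exact mul_left_cancel₀ h0 (by linear_combination a * h2 - b * h1)

theorem circleCard_zero_le : circleCard p 0 ≤ p * 2 := by
  calc circleCard p 0 ≤ ((Finset.univ : Finset (ZMod p)).sigma fun x =>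
        Finset.univ.filter fun y : ZMod p => y ^ 2 = -x ^ 2).card := by
        refine Finset.card_le_card_of_injOn (fun z => ⟨z.1, z.2⟩) ?_ ?_
        · rintro ⟨x, y⟩ hz
          simp only [Finset.coe_filter, Finset.mem_univ, true_and, Set.mem_ofPred_eq] at hz
          simp only [Finset.coe_sigma, Set.mem_sigma_iff, Finset.coe_univ, Set.mem_univ, true_and,
            Finset.coe_filter, Finset.mem_univ, Set.mem_ofPred_eq]
          linear_combination hz
        · rintro ⟨x, y⟩ _ ⟨x', y'⟩ _ h
          simpa using h
    _ ≤ p * 2 := by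
        rw [Finset.card_sigma]
        refine (Finset.sum_le_card_nsmul _ _ 2 fun x _ => card_sq_eq_le p _).trans ?_
        simp [ZMod.card]

/-- The p - 1 nondegenerate circles share at least p² - 2p = (p-1)² - 1 points equally, which
exceeds (p-1)(p-2) as p > 2. -/
theorem le_circleCard (hp : 2 < p) {c : ZMod p} (hc : c ≠ 0) : p - 1 ≤ circleCard p c := by
  have hsum : ∑ c, circleCard p c = p * p := by
    have := Finset.card_eq_sum_card_fiberwise (s := (Finset.univ : Finset (ZMod p × ZMod p)))
      (t := Finset.univ) (f := fun z => z.1 ^ 2 + z.2 ^ 2) (fun _ _ => Finset.mem_univ _)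
    rw [Finset.card_univ, Fintype.card_prod, ZMod.card] at this
    exact this.symm
  rw [← Finset.add_sum_erase _ _ (Finset.mem_univ 0)] at hsum
  have h1 : ∑ c' ∈ Finset.univ.erase 0, circleCard p c' ≤ (p - 1) * circleCard p c := by
    refine (Finset.sum_le_card_nsmul _ _ (circleCard p c) fun c' hc' =>
      circleCard_le p hc (Finset.ne_of_mem_erase hc')).trans ?_
    rw [Finset.card_erase_of_mem (Finset.mem_univ _), Finset.card_univ, ZMod.card, smul_eq_mul]
  have h2 := circleCard_zero_le p
  by_contra! hlt
  generalize circleCard p c = r at *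
  generalize circleCard p 0 = r₀ at *
  generalize ∑ c' ∈ Finset.univ.erase 0, circleCard p c' = s at *
  obtain ⟨k, rfl⟩ := Nat.exists_eq_add_of_le hp
  rw [show Nat.succ 2 + k - 1 = k + 2 by omega] at h1 hlt
  have h3 : r ≤ k + 1 := by omega
  have h4 := Nat.mul_le_mul_left (k + 2) h3
  nlinarith

/-- The number of points of the sphere used in Brown's matrix. -/
noncomputable def sphereCard : ℕ :=
  (Finset.univ.filter fun z : Fin 3 → ZMod p => ∑ i, z i ^ 2 = (brownAlpha p : ZMod p)).card

/-- The sphere is sliced by one coordinate z; at most two values of z give a degenerate circle. -/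
theorem le_sphereCard (hp : 2 < p) : (p - 2) * (p - 1) ≤ sphereCard p := by
  let α : ZMod p := brownAlpha p
  let Z : Finset (ZMod p) := Finset.univ.filter fun z => ¬ z ^ 2 = α
  have hZ : p - 2 ≤ Z.card := by
    have h1 := Finset.card_filter_add_card_filter_not (s := (Finset.univ : Finset (ZMod p)))
      (fun z => z ^ 2 = α)
    rw [Finset.card_univ, ZMod.card] at h1
    change _ + Z.card = p at h1
    have h2 := card_sq_eq_le p α
    omega
  calc (p - 2) * (p - 1) ≤ Z.card * (p - 1) := Nat.mul_le_mul_right _ hZ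
    _ ≤ ∑ z ∈ Z, circleCard p (α - z ^ 2) := by
        rw [← smul_eq_mul]
        refine Finset.card_nsmul_le_sum _ _ _ fun z hz => le_circleCard p hp ?_
        intro h
        exact (Finset.mem_filter.1 hz).2 (sub_eq_zero.1 h).symm
    _ = (Z.sigma fun z => Finset.univ.filter fun w : ZMod p × ZMod p =>
          w.1 ^ 2 + w.2 ^ 2 = α - z ^ 2).card := (Finset.card_sigma _ _).symm
    _ ≤ sphereCard p := by
        refine Finset.card_le_card_of_injOn (fun w => ![w.1, w.2.1, w.2.2]) ?_ ?_
        · rintro ⟨z, x, y⟩ hw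
          simp only [Finset.coe_sigma, Set.mem_sigma_iff, Finset.coe_filter, Finset.mem_univ,
            true_and, Set.mem_ofPred_eq] at hw
          simp only [Finset.coe_filter, Finset.mem_univ, true_and, Set.mem_ofPred_eq,
            Fin.sum_univ_three, Matrix.cons_val]
          linear_combination hw.2
        · rintro ⟨z, x, y⟩ - ⟨z', x', y'⟩ - h
          have h0 := congrFun h 0
          have h1 := congrFun h 1
          have h2 := congrFun h 2
          simp only [Matrix.cons_val] at h0 h1 h2
          subst h0 h1 h2
          rfl

theorem card_brownMatrix_row (x : Fin 3 → ZMod p) :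
    (Finset.univ.filter fun y => brownMatrix p x y = true).card = sphereCard p := by
  refine Finset.card_equiv (Equiv.subLeft x) fun y => ?_
  simp [brownMatrix]

theorem card_brownMatrix_col (y : Fin 3 → ZMod p) :
    (Finset.univ.filter fun x => brownMatrix p x y = true).card = sphereCard p := by
  refine Finset.card_equiv (Equiv.subRight y) fun x => ?_
  simp [brownMatrix]

/-- The degree d is at least p²/2, so p ≥ 16 gives d² ≥ p⁴/4 ≥ 4p³, as the counting lemma requires.
The constant is 16 · 32. -/
theorem pow_eight_le_weight_brown (hp : 16 ≤ p) (n : ℕ) :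
    p ^ 8 ≤ 512 * weight (padRect (brownMatrix p) n) := by
  have hs := le_sphereCard p (by omega)
  have hs2 : p ^ 2 ≤ 2 * sphereCard p := by
    obtain ⟨k, rfl⟩ := Nat.exists_eq_add_of_le hp
    rw [show 16 + k - 2 = 14 + k by omega, show 16 + k - 1 = 15 + k by omega] at hs
    nlinarith
  have hcard : Fintype.card (Fin 3 → ZMod p) = p ^ 3 := by simp [ZMod.card]
  have h4 : p ^ 4 ≤ 4 * sphereCard p ^ 2 := by
    calc p ^ 4 = (p ^ 2) ^ 2 := by ring
      _ ≤ (2 * sphereCard p) ^ 2 := Nat.pow_le_pow_left hs2 2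
      _ = 4 * sphereCard p ^ 2 := by ring
  have hw := pow_four_le_weight_padRect (card_brownMatrix_row p) (card_brownMatrix_col p) (by
    rw [hcard]
    have : 16 * p ^ 3 ≤ p ^ 4 := by
      rw [pow_succ' p 3]
      exact Nat.mul_le_mul_right _ hp
    omega) n
  calc p ^ 8 = (p ^ 4) ^ 2 := by ring
    _ ≤ (4 * sphereCard p ^ 2) ^ 2 := Nat.pow_le_pow_left h4 2
    _ = 16 * sphereCard p ^ 4 := by ring
    _ ≤ 512 * weight (padRect (brownMatrix p) n) := by omega

end Brown

/-! ### Brown's matrix at size n -/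

section BrownPrime

/-- The bound on `n` makes the prime 17, the first one above 16, admissible. By Bertrand's postulate
some larger prime is at most twice `brownPrime n`; it no longer fits, which gives n ≤ (2p)⁶. -/
theorem brownPrime_spec {n : ℕ} (hn : 17 ^ 6 ≤ n) :
    (brownPrime n).Prime ∧ 17 ≤ brownPrime n ∧ (brownPrime n ^ 3).choose 2 ≤ n ∧
      n ≤ 64 * brownPrime n ^ 6 := by
  have h17 : Nat.Prime 17 ∧ (17 ^ 3).choose 2 ≤ n :=
    ⟨by norm_num, (choose_two_le_sq _).trans (by rw [← pow_mul]; exact hn)⟩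
  have h17n : 17 ≤ n := le_trans (by norm_num) hn
  have hle : 17 ≤ brownPrime n := Nat.le_findGreatest h17n h17
  have hspec : (brownPrime n).Prime ∧ (brownPrime n ^ 3).choose 2 ≤ n :=
    Nat.findGreatest_spec (P := fun p => p.Prime ∧ (p ^ 3).choose 2 ≤ n) h17n h17
  refine ⟨hspec.1, hle, hspec.2, ?_⟩
  obtain ⟨q, hq, hlt, hq2⟩ := Nat.exists_prime_lt_and_le_two_mul (brownPrime n) (by omega)
  have hnot : ¬ (q ^ 3).choose 2 ≤ n := by
    intro h
    have hqn : q ≤ n := (Nat.le_self_pow three_ne_zero q).trans ((le_choose_two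
      (le_trans (by omega) (Nat.le_self_pow three_ne_zero q))).trans h)
    exact Nat.findGreatest_is_greatest hlt hqn ⟨hq, h⟩
  calc n ≤ (q ^ 3).choose 2 := (not_le.1 hnot).le
    _ ≤ (q ^ 3) ^ 2 := choose_two_le_sq _
    _ ≤ ((2 * brownPrime n) ^ 3) ^ 2 := Nat.pow_le_pow_left (Nat.pow_le_pow_left hq2 3) 2
    _ = 64 * brownPrime n ^ 6 := by ring

theorem card_brownPoints {n : ℕ} (hn : 17 ^ 6 ≤ n) :
    Nat.card (Fin 3 → ZMod (brownPrime n)) = brownPrime n ^ 3 := by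
  have := Fact.mk (brownPrime_spec hn).1
  simp [Nat.card_eq_fintype_card, ZMod.card]

theorem card_brownIndex {n : ℕ} (hn : 17 ^ 6 ≤ n) : Nat.card (BrownIndex n) = n := by
  have h := brownPrime_spec hn
  have := Fact.mk h.1
  exact card_padIndex (by rw [card_brownPoints hn]; exact h.2.2.1)

theorem OR_brownC_le {n : ℕ} (hn : 17 ^ 6 ≤ n) : OR (brownC n) ≤ 13 * n := by
  have h := brownPrime_spec hn
  have := Fact.mk h.1
  refine OR_compl_padRect_le _ ?_ ?_
  · rw [card_brownPoints hn]
    exact le_trans (by omega) (Nat.le_self_pow three_ne_zero _)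
  · rw [card_brownPoints hn]
    exact h.2.2.1

theorem isFree_compl_brownC {n : ℕ} (hn : 17 ^ 6 ≤ n) : IsFree 2 (compl (brownC n)) := by
  have h := brownPrime_spec hn
  have := Fact.mk h.1
  rw [brownC, compl_compl]
  exact isFree_padRect (r := 2) (isFree_brownMatrix _ (by omega)) n

theorem rpow_le_weight_compl_brownC {n : ℕ} (hn : 17 ^ 6 ≤ n) :
    (n : ℝ) ^ ((4 : ℝ) / 3) ≤ 131072 * weight (compl (brownC n)) := by
  have h := brownPrime_spec hn
  have := Fact.mk h.1
  rw [brownC, compl_compl]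
  have hw := pow_eight_le_weight_brown (brownPrime n) (by omega) n
  set p := brownPrime n
  set W := weight (padRect (brownMatrix p) n)
  calc (n : ℝ) ^ ((4 : ℝ) / 3) ≤ (((2 * p) ^ 6 : ℝ)) ^ ((4 : ℝ) / 3) := by
        refine Real.rpow_le_rpow (by positivity) ?_ (by norm_num)
        rw [mul_pow]
        norm_num
        exact_mod_cast h.2.2.2
    _ = (2 * p : ℝ) ^ 8 := by
        rw [← Real.rpow_natCast, ← Real.rpow_natCast, ← Real.rpow_mul (by positivity)]
        norm_num
    _ = 256 * (p ^ 8 : ℕ) := by push_cast; ring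
    _ ≤ 256 * (512 * W : ℕ) := by gcongr
    _ = 131072 * W := by push_cast; ring

end BrownPrime

/-! ### The degree of the norm-graph matrix -/

section NormDegree

variable (F : Type*) [Field F] [Fintype F]

open scoped Classical in
/-- The number of elements of norm one. -/
noncomputable def normOneCard (q t : ℕ) : ℕ :=
  (Finset.univ.filter fun z : F => ∏ i ∈ Finset.range t, z ^ (q ^ i) = 1).card

theorem card_normMatrix_row (q t : ℕ) (x : F) :
    (Finset.univ.filter fun y => normMatrix F q t x y = true).card = normOneCard F q t := by
  classical
  refine Finset.card_equiv (Equiv.addLeft x) fun y => ?_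
  simp [normMatrix]

theorem card_normMatrix_col (q t : ℕ) (y : F) :
    (Finset.univ.filter fun x => normMatrix F q t x y = true).card = normOneCard F q t := by
  classical
  refine Finset.card_equiv (Equiv.addRight y) fun x => ?_
  simp [normMatrix]

/-- The norm is the power map z ↦ z^D with D = 1 + q + ⋯ + q^t. Its kernel on the cyclic group of
order (q-1)D has exactly D elements. -/
theorem pow_le_normOneCard {q t : ℕ} (hq : 2 ≤ q) (hF : Fintype.card F = q ^ (t + 1)) :
    q ^ t ≤ normOneCard F q (t + 1) := by
  classical
  set D := ∑ i ∈ Finset.range (t + 1), q ^ i with hD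
  have hqD : q ^ t ≤ D := by
    rw [hD, Finset.sum_range_succ]
    exact Nat.le_add_left _ _
  have hker := IsCyclic.card_powMonoidHom_ker (G := Fˣ) D
  have hdvd : D ∣ Nat.card Fˣ := by
    rw [Nat.card_eq_fintype_card, Fintype.card_units, hF]
    obtain ⟨k, rfl⟩ := Nat.exists_eq_add_of_le' (show 1 ≤ q by omega)
    rw [← geom_sum_mul_add k (t + 1), Nat.add_sub_cancel]
    exact dvd_mul_right _ _
  rw [Nat.gcd_eq_right hdvd] at hker
  refine hqD.trans (hker ▸ ?_)
  rw [Nat.card_eq_fintype_card, ← Finset.card_univ, normOneCard]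
  refine Finset.card_le_card_of_injOn (fun z => ((z : Fˣ) : F)) ?_ ?_
  · intro z _
    have hz : (z : Fˣ) ^ D = 1 := z.2
    simp only [Finset.coe_filter, Finset.mem_univ, true_and, Set.mem_ofPred_eq]
    rw [Finset.prod_pow_eq_pow_sum, ← hD, ← Units.val_pow_eq_pow_val, hz, Units.val_one]
  · intro z _ z' _ h
    exact Subtype.ext (Units.ext h)

theorem pow_le_weight_normMatrix {s t : ℕ} (hs : 1 ≤ s) (ht : 4 ≤ t)
    (hF : Fintype.card F = 2 ^ (s * t)) (n : ℕ) :
    (2 ^ (s * (t - 1))) ^ 4 ≤ 32 * weight (padRect (normMatrix F (2 ^ s) t) n) := by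
  obtain ⟨k, rfl⟩ := Nat.exists_eq_add_of_le' (show 1 ≤ t by omega)
  have hd : 2 ^ (s * k) ≤ normOneCard F (2 ^ s) (k + 1) := by
    rw [pow_mul]
    exact pow_le_normOneCard F (Nat.le_self_pow (by omega) 2) (by rw [hF, pow_mul])
  have hw := pow_four_le_weight_padRect (card_normMatrix_row F (2 ^ s) (k + 1))
    (card_normMatrix_col F (2 ^ s) (k + 1)) (by
      refine le_trans ?_ (Nat.pow_le_pow_left hd 2)
      rw [hF, ← pow_mul, show 4 = 2 ^ 2 by norm_num, ← pow_add]
      refine Nat.pow_le_pow_right two_pos ?_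
      -- The density condition 4q^t ≤ q^(2(t-1)) amounts to s(t-2) ≥ 2, which t ≥ 4 secures for
      -- every s ≥ 1.
      have : 3 ≤ k := by omega
      nlinarith) n
  rw [Nat.add_sub_cancel]
  exact (Nat.pow_le_pow_left hd 4).trans hw

end NormDegree

/-! ### Parameters and the loss exponent for norm graphs -/

section Parameters

theorem sixteen_mul_le_two_pow {L : ℕ} (hL : 7 ≤ L) : 16 * L ≤ 2 ^ L := by
  induction L, hL using Nat.le_induction with
  | base => norm_num
  | succ k hk ih => rw [pow_succ]; omega

theorem le_log_log {n : ℕ} (hn : 2 ^ 128 ≤ n) :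
    128 ≤ Nat.log 2 n ∧ 7 ≤ Nat.log 2 (Nat.log 2 n) := by
  have h1 : 128 ≤ Nat.log 2 n := Nat.le_log_of_pow_le one_lt_two hn
  exact ⟨h1, Nat.le_log_of_pow_le one_lt_two (le_trans (by norm_num) h1)⟩

/-- With l and L the iterated logarithms, t is √(l/L) up to a factor 2. The last bound, from t² ≤ l
< 2^(L+1), makes (t+1)^t at most 2^(Lt). -/
theorem normDeg_bounds {n : ℕ} (hn : 2 ^ 128 ≤ n) :
    4 ≤ normDeg n ∧
      normDeg n * normDeg n * Nat.log 2 (Nat.log 2 n) ≤ Nat.log 2 n ∧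
      Nat.log 2 n ≤ 4 * (normDeg n * normDeg n) * Nat.log 2 (Nat.log 2 n) ∧
      normDeg n + 1 ≤ 2 ^ Nat.log 2 (Nat.log 2 n) := by
  obtain ⟨hl, hL⟩ := le_log_log hn
  have hpow : 2 ^ Nat.log 2 (Nat.log 2 n) ≤ Nat.log 2 n := Nat.pow_log_le_self 2 (by omega)
  have hpow' : Nat.log 2 n < 2 ^ (Nat.log 2 (Nat.log 2 n) + 1) :=
    Nat.lt_pow_succ_log_self one_lt_two _
  have h16 := sixteen_mul_le_two_pow hL
  unfold normDeg
  generalize Nat.log 2 (Nat.log 2 n) = L at *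
  generalize Nat.log 2 n = l at *
  have hL0 : 0 < L := by omega
  have h4 : 4 ≤ Nat.sqrt (l / L) := by
    rw [Nat.le_sqrt, Nat.le_div_iff_mul_le hL0]
    omega
  have hsq := Nat.sqrt_le (l / L)
  have hsq' := Nat.lt_succ_sqrt (l / L)
  generalize Nat.sqrt (l / L) = t at *
  rw [Nat.le_div_iff_mul_le hL0] at hsq
  rw [Nat.div_lt_iff_lt_mul hL0] at hsq'
  refine ⟨h4, hsq, ?_, ?_⟩
  · refine hsq'.le.trans (Nat.mul_le_mul_right _ ?_)
    nlinarith
  · by_contra! hlt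
    have h1 : 2 ^ L ≤ t := by omega
    have h2 := Nat.mul_le_mul h1 h1
    have h3 : 2 ^ (L + 1) ≤ 2 ^ L * 2 ^ L := by
      rw [pow_succ]
      exact Nat.mul_le_mul_left _ (by omega)
    have h5 : t * t ≤ t * t * L := Nat.le_mul_of_pos_right _ hL0
    omega

/-- Maximality of s gives the upper bound on `n`; the fit for s itself gives 2^(2st) ≤ 4n, hence the
last inequality. -/
theorem normExp_bounds {n : ℕ} (hn : 2 ^ 128 ≤ n) :
    1 ≤ normExp n ∧ (2 ^ (normExp n * normDeg n)).choose 2 ≤ n ∧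
      n ≤ 2 ^ (2 * ((normExp n + 1) * normDeg n)) ∧
      2 * (normExp n * normDeg n) ≤ Nat.log 2 n + 2 := by
  obtain ⟨ht, htl, -, -⟩ := normDeg_bounds hn
  obtain ⟨hl, hL⟩ := le_log_log hn
  have hn0 : n ≠ 0 := by
    rintro rfl
    simp at hn
  have hn1 : 1 ≤ n := Nat.one_le_iff_ne_zero.2 hn0
  have h1 : (2 ^ (1 * normDeg n)).choose 2 ≤ n := by
    refine (choose_two_le_sq _).trans ?_
    rw [← pow_mul]
    refine (Nat.pow_le_pow_right two_pos ?_).trans (Nat.pow_log_le_self 2 hn0)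
    have : normDeg n * normDeg n ≤ normDeg n * normDeg n * Nat.log 2 (Nat.log 2 n) :=
      Nat.le_mul_of_pos_right _ (by omega)
    nlinarith
  have hspec : (2 ^ (normExp n * normDeg n)).choose 2 ≤ n :=
    Nat.findGreatest_spec (P := fun s => (2 ^ (s * normDeg n)).choose 2 ≤ n) hn1 h1
  have hs : 1 ≤ normExp n := Nat.le_findGreatest hn1 h1
  refine ⟨hs, hspec, ?_, ?_⟩
  · have hnot : ¬ (2 ^ ((normExp n + 1) * normDeg n)).choose 2 ≤ n := by
      intro h
      have hlt : normExp n + 1 < 2 ^ ((normExp n + 1) * normDeg n) :=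
        (Nat.le_mul_of_pos_right _ (by omega)).trans_lt Nat.lt_two_pow_self
      have hle : normExp n + 1 ≤ n := hlt.le.trans ((le_choose_two (by omega)).trans h)
      exact Nat.findGreatest_is_greatest (Nat.lt_succ_self _) hle h
    calc n ≤ (2 ^ ((normExp n + 1) * normDeg n)).choose 2 := (not_le.1 hnot).le
      _ ≤ (2 ^ ((normExp n + 1) * normDeg n)) ^ 2 := choose_two_le_sq _
      _ = 2 ^ (2 * ((normExp n + 1) * normDeg n)) := by rw [← pow_mul, mul_comm]
  · have h2 : 2 ≤ 2 ^ (normExp n * normDeg n) :=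
      Nat.le_self_pow (Nat.mul_pos hs (by omega)).ne' 2
    have h3 := sq_le_four_mul_choose_two h2
    rw [← pow_mul] at h3
    have h4 : 2 ^ (normExp n * normDeg n * 2) < 2 ^ (Nat.log 2 n + 3) := by
      calc 2 ^ (normExp n * normDeg n * 2) ≤ 4 * n := h3.trans (Nat.mul_le_mul_left 4 hspec)
        _ < 4 * 2 ^ (Nat.log 2 n + 1) :=
          Nat.mul_lt_mul_of_pos_left (Nat.lt_pow_succ_log_self one_lt_two n) (by norm_num)
        _ = 2 ^ (Nat.log 2 n + 3) := by ring
    have := (Nat.pow_lt_pow_iff_right one_lt_two).1 h4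
    omega

theorem card_normField {n : ℕ} (hn : 2 ^ 128 ≤ n) :
    Nat.card (NormField n) = 2 ^ (normExp n * normDeg n) := by
  refine GaloisField.card 2 _ (Nat.mul_pos (normExp_bounds hn).1 ?_).ne'
  have := (normDeg_bounds hn).1
  omega

theorem card_normIndex {n : ℕ} (hn : 2 ^ 128 ≤ n) : Nat.card (NormIndex n) = n :=
  card_padIndex (by rw [card_normField hn]; exact (normExp_bounds hn).2.1)

theorem OR_normC_le {n : ℕ} (hn : 2 ^ 128 ≤ n) : OR (normC n) ≤ 13 * n := by
  have h := normExp_bounds hn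
  have ht := (normDeg_bounds hn).1
  refine OR_compl_padRect_le _ ?_ ?_
  · rw [card_normField hn]
    exact Nat.le_self_pow (Nat.mul_pos h.1 (by omega)).ne' 2
  · rw [card_normField hn]
    exact h.2.1

/-- No row of the complement is zero, as `x + -x` does not have norm one. -/
theorem le_OR_normC {n : ℕ} (hn : 2 ^ 128 ≤ n) : n ≤ OR (normC n) := by
  classical
  have ht := (normDeg_bounds hn).1
  conv_lhs => rw [← card_normIndex hn]
  refine card_le_OR ?_
  have hzero : ∀ x : NormField n,
      normMatrix (NormField n) (2 ^ normExp n) (normDeg n) x (-x) = false := by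
    intro x
    simp only [normMatrix, Matrix.of_apply, decide_eq_false_iff_not, add_neg_cancel]
    rw [Finset.prod_eq_zero (i := 0) (Finset.mem_range.2 (by omega)) (by simp)]
    exact zero_ne_one
  rintro (a | a)
  · obtain ⟨x, hx⟩ := Finset.card_pos.1 (show 0 < a.1.card by rw [a.2]; exact two_pos)
    obtain ⟨y, hy⟩ := exists_ne (-x)
    refine ⟨Sum.inl ⟨{-x, y}, Finset.card_pair hy.symm⟩, ?_⟩
    simp only [normC, compl, padRect, rectMatrix, Matrix.of_apply, Bool.not_eq_true',
      decide_eq_false_iff_not, not_forall, Bool.not_eq_true]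
    exact ⟨x, hx, -x, Finset.mem_insert_self _ _, hzero x⟩
  · obtain ⟨x, y, hxy⟩ := exists_pair_ne (NormField n)
    exact ⟨Sum.inl ⟨{x, y}, Finset.card_pair hxy⟩, rfl⟩

theorem OR_compl_normC_le {n : ℕ} (hn : 2 ^ 128 ≤ n) : OR (compl (normC n)) ≤ n * n := by
  have h := (OR_le_weight (compl (normC n))).trans (weight_le_mul _)
  rwa [card_normIndex hn] at h

/-- The exponent of the loss in the lower bound. -/
noncomputable def lossExp (n : ℕ) : ℕ :=
  4 * normDeg n + 4 * normExp n + 11 + 4 * (Nat.log 2 (Nat.log 2 n) * normDeg n)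

/-- The loss comes from rounding s (4t), from the degree being of order q^(t-1) (4s), and from the
counting constant 32 (5). -/
theorem sq_le_mul_weight {n : ℕ} (hn : 2 ^ 128 ≤ n) :
    n ^ 2 ≤ 2 ^ (4 * normDeg n + 4 * normExp n + 5) * weight (compl (normC n)) := by
  obtain ⟨hs, -, hns, -⟩ := normExp_bounds hn
  have ht := (normDeg_bounds hn).1
  have hcard := card_normField hn
  have := Fintype.ofFinite (NormField n)
  rw [Nat.card_eq_fintype_card] at hcard
  have hw := pow_le_weight_normMatrix (NormField n) hs ht hcard n
  rw [normC, compl_compl]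
  generalize weight (padRect (normMatrix (NormField n) (2 ^ normExp n) (normDeg n)) n) = W at *
  generalize normDeg n = t at *
  generalize normExp n = s at *
  calc n ^ 2 ≤ (2 ^ (2 * ((s + 1) * t))) ^ 2 := Nat.pow_le_pow_left hns 2
    _ = 2 ^ (4 * t + 4 * s) * (2 ^ (s * (t - 1))) ^ 4 := by
        obtain ⟨k, rfl⟩ := Nat.exists_eq_add_of_le' (show 1 ≤ t by omega)
        rw [← pow_mul, ← pow_mul, ← pow_add, Nat.add_sub_cancel]
        congr 1
        ring
    _ ≤ 2 ^ (4 * t + 4 * s) * (32 * W) := Nat.mul_le_mul_left _ hw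
    _ = _ := by ring

theorem weight_le_pow_mul_OR {n : ℕ} (hn : 2 ^ 128 ≤ n) :
    weight (compl (normC n)) ≤
      2 ^ (2 + 4 * (Nat.log 2 (Nat.log 2 n) * normDeg n)) * OR (compl (normC n)) := by
  obtain ⟨ht, -, -, htL⟩ := normDeg_bounds hn
  have hfree := isFree_padRect (isFree_normMatrix (NormField n) (normExp n) (normDeg n)
    (by omega)) n
  have hw := weight_le_mul_OR hfree
  rw [normC, compl_compl]
  refine hw.trans (Nat.mul_le_mul_right _ ?_)
  set r := (normDeg n + 1) ^ normDeg n
  have hr : r ≤ 2 ^ (Nat.log 2 (Nat.log 2 n) * normDeg n) := by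
    rw [pow_mul]
    exact Nat.pow_le_pow_left htL _
  have hk := choose_two_le_sq r
  have h1 : r.choose 2 * r.choose 2 ≤ (r ^ 2) * (r ^ 2) := Nat.mul_le_mul hk hk
  have h2 : r.choose 2 ≤ r.choose 2 * r.choose 2 := Nat.le_mul_self _
  calc r.choose 2 * r.choose 2 + 2 * r.choose 2 ≤ 4 * r ^ 4 := by
        have : r ^ 2 * r ^ 2 = r ^ 4 := by ring
        omega
    _ ≤ 4 * (2 ^ (Nat.log 2 (Nat.log 2 n) * normDeg n)) ^ 4 :=
        Nat.mul_le_mul_left _ (Nat.pow_le_pow_left hr 4)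
    _ = _ := by
        rw [← pow_mul, pow_add]
        ring

/-- The constant 11 in `lossExp` is 4 + 5 + 2, where 4 comes from 13 ≤ 2⁴. -/
theorem mul_OR_normC_le {n : ℕ} (hn : 2 ^ 128 ≤ n) :
    n * OR (normC n) ≤ 2 ^ lossExp n * OR (compl (normC n)) := by
  calc n * OR (normC n) ≤ n * (13 * n) := Nat.mul_le_mul_left _ (OR_normC_le hn)
    _ ≤ 2 ^ 4 * n ^ 2 := by nlinarith
    _ ≤ 2 ^ 4 * (2 ^ (4 * normDeg n + 4 * normExp n + 5) *
          (2 ^ (2 + 4 * (Nat.log 2 (Nat.log 2 n) * normDeg n)) * OR (compl (normC n)))) :=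
        Nat.mul_le_mul_left _ ((sq_le_mul_weight hn).trans
          (Nat.mul_le_mul_left _ (weight_le_pow_mul_OR hn)))
    _ = 2 ^ lossExp n * OR (compl (normC n)) := by
        rw [← mul_assoc, ← mul_assoc, ← pow_add, ← pow_add]
        congr 2
        unfold lossExp
        ring

/-- With y = √(lL) one has t ≤ Lt ≤ y, s ≤ 2y and 1 ≤ y, so 27 = 4 + 8 + 11 + 4. -/
theorem lossExp_le {n : ℕ} (hn : 2 ^ 128 ≤ n) :
    (lossExp n : ℝ) ≤ 27 * Real.sqrt (Nat.log 2 n * Nat.log 2 (Nat.log 2 n) : ℕ) := by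
  obtain ⟨ht, htl, hlt, -⟩ := normDeg_bounds hn
  obtain ⟨-, -, -, hst⟩ := normExp_bounds hn
  obtain ⟨hl, hL⟩ := le_log_log hn
  unfold lossExp
  generalize Nat.log 2 (Nat.log 2 n) = L at *
  generalize Nat.log 2 n = l at *
  generalize normDeg n = t at *
  generalize normExp n = s at *
  have h1 : (L * t) ^ 2 ≤ l * L := by
    calc (L * t) ^ 2 = t * t * L * L := by ring
      _ ≤ l * L := Nat.mul_le_mul_right _ htl
  have h2 : s ^ 2 ≤ 4 * (l * L) := by
    have h3 : s * t ≤ l := by omega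
    have h4 := Nat.pow_le_pow_left h3 2
    refine Nat.le_of_mul_le_mul_left (c := l) ?_ (by omega)
    calc l * s ^ 2 ≤ 4 * (t * t) * L * s ^ 2 := Nat.mul_le_mul_right _ hlt
      _ = 4 * L * (s * t) ^ 2 := by ring
      _ ≤ 4 * L * l ^ 2 := Nat.mul_le_mul_left _ h4
      _ = l * (4 * (l * L)) := by ring
  set y := Real.sqrt (l * L : ℕ) with hy
  have hy2 : y ^ 2 = (l * L : ℕ) := Real.sq_sqrt (by positivity)
  have hy0 : 0 ≤ y := Real.sqrt_nonneg _
  have e1 : ((L * t : ℕ) : ℝ) ≤ y := by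
    refine Real.le_sqrt_of_sq_le ?_
    exact_mod_cast h1
  have e2 : (s : ℝ) ≤ 2 * y := by
    refine abs_le_of_sq_le_sq' ?_ (by positivity) |>.2
    rw [mul_pow, hy2]
    have : ((s ^ 2 : ℕ) : ℝ) ≤ ((4 * (l * L) : ℕ) : ℝ) := by exact_mod_cast h2
    push_cast at this ⊢
    linarith
  have e3 : (1 : ℝ) ≤ y := by
    refine Real.le_sqrt_of_sq_le ?_
    have : 1 ≤ l * L := Nat.mul_pos (by omega) (by omega)
    have : (1 : ℝ) ≤ (l * L : ℕ) := by exact_mod_cast this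
    linarith
  have e4 : (t : ℝ) ≤ (L * t : ℕ) := by
    exact_mod_cast Nat.le_mul_of_pos_left t (by omega)
  push_cast at e1 e4 ⊢
  linarith

theorem log_mul_loglog_le {n : ℕ} (hn : 2 ^ 128 ≤ n) :
    ((Nat.log 2 n * Nat.log 2 (Nat.log 2 n) : ℕ) : ℝ) ≤
      3 ^ 2 * (Real.log n * Real.log (Real.log n)) := by
  obtain ⟨hl, hL⟩ := le_log_log hn
  have hn0 : n ≠ 0 := by
    rintro rfl
    simp at hn
  -- This yields l ≤ 2 ln n and L ≤ 4 ln ln n. The resulting factor 8 is rounded up to 3², so that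
  -- its root is rational.
  have hlog2 : (1 / 2 : ℝ) ≤ Real.log 2 := by
    have := Real.log_two_gt_d9
    linarith
  have hcast : ∀ m : ℕ, m ≠ 0 → (Nat.log 2 m : ℝ) * Real.log 2 ≤ Real.log m := by
    intro m hm
    rw [← Real.log_pow]
    refine Real.log_le_log (by positivity) ?_
    exact_mod_cast Nat.pow_log_le_self 2 hm
  have h1 := hcast n hn0
  have h2 := hcast (Nat.log 2 n) (by omega)
  have hl' : (128 : ℝ) ≤ Nat.log 2 n := by exact_mod_cast hl
  generalize Nat.log 2 (Nat.log 2 n) = L at *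
  generalize Nat.log 2 n = l at *
  have h3 : (l : ℝ) ≤ 2 * Real.log n := by nlinarith
  have h4 : Real.log l ≤ 2 * Real.log (Real.log n) := by
    have h5 : Real.log l ≤ Real.log (Real.log n ^ 2) :=
      Real.log_le_log (by linarith) (by nlinarith)
    rwa [Real.log_pow, Nat.cast_ofNat] at h5
  have hL0 : (0 : ℝ) ≤ L := Nat.cast_nonneg _
  have h5 : (L : ℝ) ≤ 4 * Real.log (Real.log n) := by nlinarith
  push_cast
  have h6 := mul_le_mul h3 h5 hL0 (by linarith)
  have h7 : 0 ≤ Real.log n * Real.log (Real.log n) :=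
    mul_nonneg (by linarith) (by linarith)
  linarith

end Parameters

/-! ### The ratio of the complexities -/

section Ratio

/-- The loss in the ratio of the OR-complexities. -/
noncomputable def lossFun (n : ℕ) : ℝ :=
  -- The maximum only secures nonnegativity for small `n`. For large `n` the ratio is at most `n`,
  -- because the numerator is at most n² and the denominator at least n.
  max 0 (-Real.logb 2 ((OR (compl (normC n)) : ℝ) / (OR (normC n) : ℝ) / n))

theorem lossFun_spec {n : ℕ} (hn : 2 ^ 128 ≤ n) :
    lossFun n ≤ lossExp n ∧
      (OR (compl (normC n)) : ℝ) / (OR (normC n) : ℝ) = (n : ℝ) * (2 : ℝ) ^ (-(lossFun n)) := by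
  have hn0 : 0 < n := lt_of_lt_of_le (by norm_num) hn
  have hC := le_OR_normC hn
  have hC0 : 0 < OR (normC n) := hn0.trans_le hC
  have hup : OR (compl (normC n)) ≤ n * OR (normC n) :=
    (OR_compl_normC_le hn).trans (Nat.mul_le_mul_left _ hC)
  have hlow := mul_OR_normC_le hn
  have hB0 : 0 < OR (compl (normC n)) := by
    by_contra! h
    have h0 : OR (compl (normC n)) = 0 := by omega
    rw [h0, mul_zero] at hlow
    exact absurd hlow (not_le.2 (Nat.mul_pos hn0 hC0))
  set b := OR (compl (normC n)) with hb
  set c := OR (normC n) with hc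
  have hnR : (0 : ℝ) < n := by exact_mod_cast hn0
  have hbR : (0 : ℝ) < b := by exact_mod_cast hB0
  have hcR : (0 : ℝ) < c := by exact_mod_cast hC0
  have hx0 : (0 : ℝ) < (b : ℝ) / c / n := by positivity
  have hx1 : (b : ℝ) / c / n ≤ 1 := by
    rw [div_div, div_le_one (by positivity), mul_comm]
    exact_mod_cast hup
  have hxE : ((2 : ℝ) ^ (lossExp n))⁻¹ ≤ (b : ℝ) / c / n := by
    rw [div_div, le_div_iff₀ (by positivity), inv_mul_le_iff₀ (by positivity), mul_comm (c : ℝ)]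
    exact_mod_cast hlow
  have hlog : Real.logb 2 ((b : ℝ) / c / n) ≤ 0 := Real.logb_nonpos one_lt_two hx0.le hx1
  have hf : lossFun n = -Real.logb 2 ((b : ℝ) / c / n) := max_eq_right (by linarith)
  refine ⟨?_, ?_⟩
  · have h1 := Real.logb_le_logb_of_le one_lt_two (by positivity) hxE
    rw [Real.logb_inv, Real.logb_pow, Real.logb_self_eq_one one_lt_two, mul_one] at h1
    rw [hf]
    linarith
  · rw [hf, neg_neg, Real.rpow_logb two_pos (by norm_num) hx0]
    field_simp

theorem lossFun_le {n : ℕ} (hn : 2 ^ 128 ≤ n) :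
    lossFun n ≤ 81 * Real.sqrt (Real.log n * Real.log (Real.log n)) := by
  calc lossFun n ≤ lossExp n := (lossFun_spec hn).1
    _ ≤ 27 * Real.sqrt (Nat.log 2 n * Nat.log 2 (Nat.log 2 n) : ℕ) := lossExp_le hn
    _ ≤ 27 * Real.sqrt (3 ^ 2 * (Real.log n * Real.log (Real.log n))) := by
        gcongr
        exact log_mul_loglog_le hn
    _ = 81 * Real.sqrt (Real.log n * Real.log (Real.log n)) := by
        rw [Real.sqrt_mul (by norm_num), Real.sqrt_sq (by norm_num)]
        ring

end Ratio

end RelOR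

/-- The cardinality clauses confirm that the index types have exactly `n` elements: the subtraction
in `PadIndex` is truncated, so this holds only if the pairs fit. -/
theorem mainTheorem1 :
    -- (i)
    ((∀ᶠ n : ℕ in atTop, Nat.card (RelOR.NormIndex n) = n) ∧
      ∃ f : ℕ → ℝ, (∀ n, 0 ≤ f n) ∧
        f =O[atTop] (fun n : ℕ => Real.sqrt (Real.log n * Real.log (Real.log n))) ∧
        ∀ᶠ n : ℕ in atTop, 0 < RelOR.OR (RelOR.normC n) ∧
          (RelOR.OR (RelOR.compl (RelOR.normC n)) : ℝ) / (RelOR.OR (RelOR.normC n) : ℝ) =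
            (n : ℝ) * (2 : ℝ) ^ (-(f n))) ∧
    -- (ii)
    ((∀ᶠ n : ℕ in atTop, Nat.card (RelOR.BrownIndex n) = n) ∧
      (fun n : ℕ => (RelOR.OR (RelOR.brownC n) : ℝ)) =O[atTop] (fun n : ℕ => (n : ℝ)) ∧
      (∀ᶠ n : ℕ in atTop, RelOR.IsFree 2 (RelOR.compl (RelOR.brownC n))) ∧
      (fun n : ℕ => (n : ℝ) ^ ((4 : ℝ) / 3)) =O[atTop]
        (fun n : ℕ => (RelOR.weight (RelOR.compl (RelOR.brownC n)) : ℝ))) := by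
  have hN : ∀ᶠ n : ℕ in atTop, 2 ^ 128 ≤ n := eventually_ge_atTop _
  have hB : ∀ᶠ n : ℕ in atTop, 17 ^ 6 ≤ n := eventually_ge_atTop _
  have hnonneg : ∀ n, 0 ≤ RelOR.lossFun n := fun n => le_max_left _ _
  refine ⟨⟨hN.mono fun n hn => RelOR.card_normIndex hn, RelOR.lossFun, hnonneg, ?_,
    hN.mono fun n hn => ⟨lt_of_lt_of_le (lt_of_lt_of_le (by norm_num) hn) (RelOR.le_OR_normC hn),
      (RelOR.lossFun_spec hn).2⟩⟩,
    hB.mono fun n hn => RelOR.card_brownIndex hn, ?_,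
    hB.mono fun n hn => RelOR.isFree_compl_brownC hn, ?_⟩
  · refine IsBigO.of_bound 81 (hN.mono fun n hn => ?_)
    rw [Real.norm_of_nonneg (hnonneg n), Real.norm_of_nonneg (Real.sqrt_nonneg _)]
    exact RelOR.lossFun_le hn
  · refine IsBigO.of_bound 13 (hB.mono fun n hn => ?_)
    rw [Real.norm_of_nonneg (by positivity), Real.norm_of_nonneg (by positivity)]
    exact_mod_cast RelOR.OR_brownC_le hn
  · refine IsBigO.of_bound 131072 (hB.mono fun n hn => ?_)
    rw [Real.norm_of_nonneg (by positivity), Real.norm_of_nonneg (by positivity)]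
    exact RelOR.rpow_le_weight_compl_brownC hn
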